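/- Let $k$ be a field and let $N\hookrightarrow M$ be a symmetric Markov extension of $k$-algebras: there are an $N$-bimodule map $E:M\to N$, elements $x_1,\dots,x_n,y_1,\dots,y_n\in M$, a nonzero $\lambda\in k$ and a trace $T:N\to k$ such that $$\sum_i E(mx_i)y_i=m=\sum_i x_iE(y_im)\quad(m\in M),\qquad E(1)=1,\qquad \sum_i x_iy_i=\lambda^{-1}1,$$ $T(1)=1$, $T_0:=T\circ E$ is a trace on $M$, and $E(ux)=E(xu)$ for all $x\in M$ and all $u\in U:=C_M(N)$ (the centralizer of $N$ in $M$). For such data the basic construction is the algebra $M_1=\operatorname{End}(M_N)$ of right $N$-linear endomorphisms of $M$; it contains $M$ as left multiplications and the idempotent $e_1=E$, and it has the conditional expectation $E_M:M_1\to M$, $E_M(f)=\lambda\sum_i f(x_i)y_i$, so that $E_M(me_1m')=\lambda mm'$. Then $M_1/M$ is again a Markov extension, with expectation $E_M$, dual bases $\lambda^{-1}x_ie_1,\ e_1y_i$, the same $\lambda$, and Markov trace $T_0$. Iterating gives $M_2=\operatorname{End}((M_1)_M)$, the idempotent $e_2=E_M\in M_2$ and $E_{M_1}:M_2\to M_1$.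 Put $T_1=T_0\circ E_M$ and $T_2=T_1\circ E_{M_1}$, and $$A=C_{M_1}(N),\qquad B=C_{M_2}(M),\qquad V=C_{M_1}(M).$$ Assume: 1. $\sum_i y_ix_i=\lambda^{-1}1$; or, alternatively, $T_1\bigl(\sum_i x_iue_1y_i\bigr)=T_0(u)$ for all $u\in U$; 2. $U$ is Kanzaki separable (it has a symmetric separability element) and $T_0|_U$ is non-degenerate; 3. (depth 2) $E_M$ has dual bases contained in $A$, and $E_{M_1}$ has dual bases contained in $B$. Then $V$ has a unique symmetric separability element $f=\sum f^{(1)}\otimes f^{(2)}$, and $\sum f^{(1)}T_1(f^{(2)})$ is invertible in $V$; let $w$ be its inverse. The bilinear form $$\langle a,b\rangle=\lambda^{-2}\,T_2(ae_2e_1wb)\qquad(a\in A,\ b\in B)$$ is non-degenerate. There is a weak Hopf algebra structure $(\Delta,\varepsilon,S)$ on the algebra $B$ such that for all $a,a'\in A$, $b\in B$ $$\langle a,b_{(1)}\rangle\langle a',b_{(2)}\rangle=\langle aa',b\rangle,\qquad \varepsilon(b)=\langle 1,b\rangle,\qquad \langle a,b\rangle=\lambda^{-2}\,T_2(S(b)e_1e_2wa),$$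 and its target counital subalgebra $B_t$ is $V$. The formula $$b\triangleright x=\lambda^{-1}E_{M_1}(bxe_2)\qquad(b\in B,\ x\in M_1)$$ makes $M_1$ a left $B$-module algebra. Let $M_1\# B$ be the smash product algebra: the vector space $M_1\otimes_V B$, where $V=B_t$ acts on $B$ by left multiplication and on $M_1$ by $x\cdot v=x(v\triangleright 1)$, with multiplication $(x\# b)(y\# c)=x(b_{(1)}\triangleright y)\# b_{(2)}c$ and unit $1\#1$. Then $$\psi:M_1\# B\to M_2,\qquad \psi(x\# b)=xb,$$ is a well-defined isomorphism of $k$-algebras. -/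

import Mathlib

open scoped TensorProduct

/-! # Weak Hopf algebras, module algebras and smash products -/

/-- A weak Hopf algebra over a field `k`: a `k`-vector space with an algebra structure and a
coalgebra structure `(Δ, ε)` satisfying the weak bialgebra axioms, and an antipode. -/
class WeakHopfAlgebra (k H : Type*) [Field k] [Ring H] [Algebra k H] extends Coalgebra k H where
  /-- The antipode `S`. -/
  antipode : H →ₗ[k] H
  /-- `Δ(hg) = Δ(h)Δ(g)` -/
  comul_mul : ∀ h g : H, comul (h * g) = comul h * comul g
  /-- `ε(hgf) = ε(h g₁) ε(g₂ f)` -/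
  counit_mul_mul : ∀ h g f : H, counit (h * g * f) =
    LinearMap.mul' k k (TensorProduct.map (counit ∘ₗ LinearMap.mulLeft k h)
      (counit ∘ₗ LinearMap.mulRight k f) (comul g))
  /-- `ε(hgf) = ε(h g₂) ε(g₁ f)` -/
  counit_mul_mul' : ∀ h g f : H, counit (h * g * f) =
    LinearMap.mul' k k (TensorProduct.map (counit ∘ₗ LinearMap.mulRight k f)
      (counit ∘ₗ LinearMap.mulLeft k h) (comul g))
  /-- `(Δ ⊗ id)Δ(1) = (Δ(1) ⊗ 1)(1 ⊗ Δ(1))` -/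
  comul_one : LinearMap.rTensor H comul (comul (1 : H)) =
    (comul (1 : H) ⊗ₜ[k] (1 : H)) *
      (TensorProduct.assoc k H H H).symm ((1 : H) ⊗ₜ[k] comul (1 : H))
  /-- `(Δ ⊗ id)Δ(1) = (1 ⊗ Δ(1))(Δ(1) ⊗ 1)` -/
  comul_one' : LinearMap.rTensor H comul (comul (1 : H)) =
    (TensorProduct.assoc k H H H).symm ((1 : H) ⊗ₜ[k] comul (1 : H)) *
      (comul (1 : H) ⊗ₜ[k] (1 : H))
  /-- `h₁ S(h₂) = (ε ⊗ id)(Δ(1)(h ⊗ 1))` -/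
  mul_antipode : ∀ h : H,
    LinearMap.mul' k H (LinearMap.lTensor H antipode (comul h)) =
      TensorProduct.lid k H (LinearMap.rTensor H counit (comul (1 : H) * (h ⊗ₜ[k] (1 : H))))
  /-- `S(h₁) h₂ = (id ⊗ ε)((1 ⊗ h)Δ(1))` -/
  antipode_mul : ∀ h : H,
    LinearMap.mul' k H (LinearMap.rTensor H antipode (comul h)) =
      TensorProduct.rid k H (LinearMap.lTensor H counit (((1 : H) ⊗ₜ[k] h) * comul (1 : H)))
  /-- `S(h₁) h₂ S(h₃) = S(h)` -/
  antipode_mul_antipode : ∀ h : H,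
    LinearMap.mul' k H (TensorProduct.map
      (LinearMap.mul' k H ∘ₗ LinearMap.rTensor H antipode ∘ₗ comul) antipode (comul h)) =
      antipode h

namespace WeakHopfAlgebra

open Coalgebra

section

variable (k : Type*) {H : Type*} [Field k] [Ring H] [Algebra k H] [WeakHopfAlgebra k H]

/-- The target counital map `ε_t(h) = (ε ⊗ id)(Δ(1)(h ⊗ 1))`. -/
noncomputable def targetMap : H →ₗ[k] H :=
  (TensorProduct.lid k H).toLinearMap ∘ₗ LinearMap.rTensor H (counit (R := k) (A := H)) ∘ₗ
    LinearMap.mulLeft k (comul (R := k) (1 : H)) ∘ₗ (TensorProduct.mk k H H).flip 1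

lemma targetMap_apply (h : H) : targetMap k h =
    TensorProduct.lid k H (LinearMap.rTensor H (counit (R := k) (A := H))
      (comul (R := k) (1 : H) * (h ⊗ₜ[k] (1 : H)))) := rfl

variable (H) in
/-- The target counital subalgebra `H_t = {h | ε_t(h) = h}`, as a subset of `H`. -/
def target : Set H := {h | targetMap k h = h}

/-- A left `H`-module algebra `A`: an algebra which is a left `H`-module, with
`h · (ab) = (h₁ · a)(h₂ · b)` and `h · 1 = ε_t(h) · 1`. -/
class ModuleAlgebra (k H A : Type*) [Field k] [Ring H] [Algebra k H] [WeakHopfAlgebra k H]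
    [Ring A] [Algebra k A] where
  /-- The action of `H` on `A` by `k`-linear maps. -/
  act : H →ₐ[k] Module.End k A
  act_mul : ∀ (h : H) (a b : A), act h (a * b) =
    LinearMap.mul' k A (TensorProduct.map (act.toLinearMap.flip a) (act.toLinearMap.flip b)
      (comul (R := k) h))
  act_one : ∀ h : H, act h 1 = act (targetMap k h) 1

end

section Counital

variable {k H : Type*} [Field k] [Ring H] [Algebra k H] [WeakHopfAlgebra k H]

lemma lTensor_comul_one :
    LinearMap.lTensor H (comul (R := k)) (comul (R := k) (1 : H)) =
      TensorProduct.assoc k H H H (comul (R := k) (1 : H) ⊗ₜ[k] (1 : H)) *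
        ((1 : H) ⊗ₜ[k] comul (R := k) (1 : H)) := by
  rw [← Coalgebra.coassoc_apply, comul_one]
  exact (map_mul (Algebra.TensorProduct.assoc k k k H H H) _ _).trans
    (congrArg _ (LinearEquiv.apply_symm_apply (TensorProduct.assoc k H H H) _))

lemma lTensor_comul_one' :
    LinearMap.lTensor H (comul (R := k)) (comul (R := k) (1 : H)) =
      ((1 : H) ⊗ₜ[k] comul (R := k) (1 : H)) *
        TensorProduct.assoc k H H H (comul (R := k) (1 : H) ⊗ₜ[k] (1 : H)) := by
  rw [← Coalgebra.coassoc_apply, comul_one']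
  exact (map_mul (Algebra.TensorProduct.assoc k k k H H H) _ _).trans
    (congrArg (· * _) (LinearEquiv.apply_symm_apply (TensorProduct.assoc k H H H) _))

lemma comul_lid (T : H ⊗[k] H) (z : H) :
    comul (R := k) (TensorProduct.lid k H (LinearMap.rTensor H (counit (R := k) (A := H))
      (T * (z ⊗ₜ[k] (1 : H))))) =
    TensorProduct.lid k (H ⊗[k] H) (LinearMap.rTensor (H ⊗[k] H) (counit (R := k) (A := H))
      (LinearMap.lTensor H (comul (R := k)) T * (z ⊗ₜ[k] (1 : H ⊗[k] H)))) := by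
  induction T with
  | zero => simp
  | add x y hx hy => simp only [add_mul, map_add, hx, hy]
  | tmul x y => simp

lemma comul_of_mem_target {z : H} (hz : z ∈ target k H) :
    comul (R := k) z = (z ⊗ₜ[k] (1 : H)) * comul (R := k) (1 : H) := by
  have h1 : targetMap k z = z := hz
  have key : ∀ T U : H ⊗[k] H,
      TensorProduct.lid k (H ⊗[k] H) (LinearMap.rTensor (H ⊗[k] H) (counit (R := k) (A := H))
        (TensorProduct.assoc k H H H (T ⊗ₜ[k] (1 : H)) * ((1 : H) ⊗ₜ[k] U) *
          (z ⊗ₜ[k] (1 : H ⊗[k] H)))) =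
      (TensorProduct.lid k H (LinearMap.rTensor H (counit (R := k) (A := H))
        (T * (z ⊗ₜ[k] (1 : H)))) ⊗ₜ[k] (1 : H)) * U := by
    intro T U
    induction T with
    | zero => simp
    | add x y hx hy =>
      simp only [add_mul, map_add, TensorProduct.add_tmul, hx, hy]
    | tmul x y =>
      simp [Algebra.TensorProduct.tmul_mul_tmul, ← TensorProduct.smul_tmul']
  conv_lhs => rw [← h1]
  rw [targetMap_apply, comul_lid, lTensor_comul_one, key, ← targetMap_apply, h1]

lemma comul_of_mem_target' {z : H} (hz : z ∈ target k H) :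
    comul (R := k) z = comul (R := k) (1 : H) * (z ⊗ₜ[k] (1 : H)) := by
  have h1 : targetMap k z = z := hz
  have key : ∀ T U : H ⊗[k] H,
      TensorProduct.lid k (H ⊗[k] H) (LinearMap.rTensor (H ⊗[k] H) (counit (R := k) (A := H))
        (((1 : H) ⊗ₜ[k] U) * TensorProduct.assoc k H H H (T ⊗ₜ[k] (1 : H)) *
          (z ⊗ₜ[k] (1 : H ⊗[k] H)))) =
      U * (TensorProduct.lid k H (LinearMap.rTensor H (counit (R := k) (A := H))
        (T * (z ⊗ₜ[k] (1 : H)))) ⊗ₜ[k] (1 : H)) := by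
    intro T U
    induction T with
    | zero => simp
    | add x y hx hy =>
      simp only [add_mul, mul_add, map_add, TensorProduct.add_tmul, hx, hy]
    | tmul x y =>
      simp [Algebra.TensorProduct.tmul_mul_tmul, ← TensorProduct.smul_tmul']
  conv_lhs => rw [← h1]
  rw [targetMap_apply, comul_lid, lTensor_comul_one', key, ← targetMap_apply, h1]

lemma comul_one_mul (h : H) :
    comul (R := k) (1 : H) * comul (R := k) h = comul (R := k) h := by
  rw [← comul_mul, one_mul]

lemma comul_mul_one (h : H) :
    comul (R := k) h * comul (R := k) (1 : H) = comul (R := k) h := by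
  rw [← comul_mul, mul_one]

lemma lTensor_targetMap_comul_one :
    LinearMap.lTensor H (targetMap k) (comul (R := k) (1 : H)) = comul (R := k) (1 : H) := by
  have key : ∀ T U : H ⊗[k] H,
      LinearMap.lTensor H ((TensorProduct.lid k H).toLinearMap ∘ₗ
          LinearMap.rTensor H (counit (R := k) (A := H)))
        (((1 : H) ⊗ₜ[k] U) * TensorProduct.assoc k H H H (T ⊗ₜ[k] (1 : H))) =
      LinearMap.lTensor H ((TensorProduct.lid k H).toLinearMap ∘ₗ
          LinearMap.rTensor H (counit (R := k) (A := H)) ∘ₗ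
          LinearMap.mulLeft k U ∘ₗ (TensorProduct.mk k H H).flip 1) T := by
    intro T U
    induction T with
    | zero => simp
    | add x y hx hy => simp only [mul_add, map_add, TensorProduct.add_tmul, hx, hy]
    | tmul x y => simp [Algebra.TensorProduct.tmul_mul_tmul]
  have h2 : (TensorProduct.lid k H).toLinearMap ∘ₗ
      LinearMap.rTensor H (counit (R := k) (A := H)) ∘ₗ comul (R := k) = LinearMap.id := by
    ext x
    simp
  unfold targetMap
  rw [← key, ← lTensor_comul_one', ← LinearMap.comp_apply, ← LinearMap.lTensor_comp,
    LinearMap.comp_assoc, h2]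
  simp

lemma targetMap_mem_target (h : H) : targetMap k h ∈ target k H := by
  have key : ∀ T : H ⊗[k] H,
      targetMap k (TensorProduct.lid k H (LinearMap.rTensor H (counit (R := k) (A := H))
        (T * (h ⊗ₜ[k] (1 : H))))) =
      TensorProduct.lid k H (LinearMap.rTensor H (counit (R := k) (A := H))
        (LinearMap.lTensor H (targetMap k) T * (h ⊗ₜ[k] (1 : H)))) := by
    intro T
    induction T with
    | zero => simp
    | add x y hx hy => simp only [add_mul, map_add, hx, hy]
    | tmul x y => simp
  show targetMap k (targetMap k h) = targetMap k h
  conv_lhs => rw [targetMap_apply k h, key, lTensor_targetMap_comul_one]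
  rw [targetMap_apply k h]

lemma mul_rTensor_targetMap_comul (h : H) :
    LinearMap.mul' k H (LinearMap.rTensor H (targetMap k) (comul (R := k) h)) = h := by
  have key : ∀ T U : H ⊗[k] H,
      LinearMap.mul' k H (LinearMap.rTensor H ((TensorProduct.lid k H).toLinearMap ∘ₗ
          LinearMap.rTensor H (counit (R := k) (A := H)) ∘ₗ
          LinearMap.mulLeft k U ∘ₗ (TensorProduct.mk k H H).flip 1) T) =
      TensorProduct.lid k H (LinearMap.rTensor H (counit (R := k) (A := H)) (U * T)) := by
    intro T U
    induction T with
    | zero => simp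
    | add x y hx hy => simp only [mul_add, map_add, hx, hy]
    | tmul x y =>
      induction U with
      | zero => simp
      | add u v hu hv =>
        simp only [LinearMap.rTensor_tmul, LinearMap.comp_apply, LinearMap.mulLeft_apply,
          LinearMap.mul'_apply, add_mul, map_add] at hu hv ⊢
        rw [hu, hv]
      | tmul u v => simp
  unfold targetMap
  rw [key, comul_one_mul]
  simp

end Counital

section Smash

open ModuleAlgebra

variable (k H A : Type*) [Field k] [Ring H] [Algebra k H] [WeakHopfAlgebra k H]
  [Ring A] [Algebra k A] [ModuleAlgebra k H A]

/-- The relations `(a · z) ⊗ h = a ⊗ z h` for `z ∈ H_t`, where `a · z = a (z · 1)`. -/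
def smashRel : Submodule k (A ⊗[k] H) :=
  Submodule.span k {t | ∃ (a : A) (h z : H), z ∈ target k H ∧
    t = (a * act (k := k) z (1 : A)) ⊗ₜ[k] h - a ⊗ₜ[k] (z * h)}

/-- The smash product `A # H`; its underlying vector space is `A ⊗_{H_t} H`. -/
def SmashProduct : Type _ := (A ⊗[k] H) ⧸ smashRel k H A

noncomputable instance : AddCommGroup (SmashProduct k H A) :=
  inferInstanceAs (AddCommGroup ((A ⊗[k] H) ⧸ smashRel k H A))

noncomputable instance : Module k (SmashProduct k H A) :=
  inferInstanceAs (Module k ((A ⊗[k] H) ⧸ smashRel k H A))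

/-- The quotient map `A ⊗ H → A # H`. -/
noncomputable def smashQuot : A ⊗[k] H →ₗ[k] SmashProduct k H A := (smashRel k H A).mkQ

variable {H A} in
/-- The class `a # h` of `a ⊗ h`. -/
noncomputable def smash (a : A) (h : H) : SmashProduct k H A := smashQuot k H A (a ⊗ₜ[k] h)

/-- The linear map `g ⊗ g' ↦ (g · b) ⊗ g'`. -/
noncomputable def tw (b : A) : H ⊗[k] H →ₗ[k] A ⊗[k] H :=
  LinearMap.rTensor H ((act (k := k) (H := H) (A := A)).toLinearMap.flip b)

/-- The bilinear map `(a ⊗ h, b ⊗ g) ↦ a (h₁ · b) ⊗ h₂ g`, before passing to the quotient. -/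
noncomputable def preMul : A ⊗[k] H →ₗ[k] A ⊗[k] H →ₗ[k] A ⊗[k] H :=
  (TensorProduct.lift (LinearMap.mk₂ k (fun (b : A) (g : H) =>
    LinearMap.mulRight k ((1 : A) ⊗ₜ[k] g) ∘ₗ
      TensorProduct.lift (((LinearMap.mul k (A ⊗[k] H)).comp
        (Algebra.TensorProduct.includeLeft (R := k) (S := k) (A := A) (B := H)).toLinearMap).compl₂
          (LinearMap.rTensor H ((act (k := k) (H := H) (A := A)).toLinearMap.flip b) ∘ₗ
            comul (R := k) (A := H))))
    (by intro b b' g; ext; simp [LinearMap.rTensor_add, mul_add, add_mul])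
    (by intro c b g; ext; simp [LinearMap.rTensor_smul])
    (by intro b g g'; ext; simp [TensorProduct.tmul_add, mul_add])
    (by intro c b g; ext; simp))).flip

lemma preMul_tmul (a b : A) (h g : H) :
    preMul k H A (a ⊗ₜ[k] h) (b ⊗ₜ[k] g) =
      (a ⊗ₜ[k] (1 : H)) * tw k H A b (comul (R := k) h) * ((1 : A) ⊗ₜ[k] g) := by
  simp [preMul, tw]

/-- The linear map `p ⊗ (q ⊗ r) ↦ (p · b)(q · c) ⊗ r`. -/
noncomputable def tw₃ (b c : A) : H ⊗[k] (H ⊗[k] H) →ₗ[k] A ⊗[k] H :=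
  LinearMap.rTensor H (LinearMap.mul' k A) ∘ₗ
    (TensorProduct.assoc k A A H).symm.toLinearMap ∘ₗ
    TensorProduct.map ((act (k := k) (H := H) (A := A)).toLinearMap.flip b) (tw k H A c)

variable {H A}

lemma tw_tmul (b : A) (g h : H) :
    tw k H A b (g ⊗ₜ[k] h) = (act (k := k) g b) ⊗ₜ[k] h := rfl

lemma tw₃_tmul (b c : A) (p : H) (S : H ⊗[k] H) :
    tw₃ k H A b c (p ⊗ₜ[k] S) = ((act (k := k) p b) ⊗ₜ[k] (1 : H)) * tw k H A c S := by
  induction S with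
  | zero => simp
  | add x y hx hy => simp only [TensorProduct.tmul_add, mul_add, map_add, hx, hy]
  | tmul x y => simp [tw₃, tw_tmul]

lemma tw_mul_one_tmul (b : A) (S : H ⊗[k] H) (g : H) :
    tw k H A b (S * ((1 : H) ⊗ₜ[k] g)) = tw k H A b S * ((1 : A) ⊗ₜ[k] g) := by
  induction S with
  | zero => simp
  | add x y hx hy => simp only [add_mul, map_add, hx, hy]
  | tmul x y => simp [tw_tmul]

lemma act_mul_tmul (b c : A) (u v : H) :
    ∀ T : H ⊗[k] H, tw k H A (b * act (k := k) u c) T * ((1 : A) ⊗ₜ[k] v) =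
      tw₃ k H A b c (TensorProduct.assoc k H H H (LinearMap.rTensor H (comul (R := k)) T) *
        ((1 : H) ⊗ₜ[k] (u ⊗ₜ[k] v))) := by
  intro T
  have key : ∀ (S : H ⊗[k] H) (y : H),
      (LinearMap.mul' k A (TensorProduct.map
        ((act (k := k) (H := H) (A := A)).toLinearMap.flip b)
        ((act (k := k) (H := H) (A := A)).toLinearMap.flip (act (k := k) u c)) S)) ⊗ₜ[k] (y * v) =
      tw₃ k H A b c (TensorProduct.assoc k H H H (S ⊗ₜ[k] y) *
        ((1 : H) ⊗ₜ[k] (u ⊗ₜ[k] v))) := by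
    intro S y
    induction S with
    | zero => simp
    | add x y hx hy => simp only [TensorProduct.add_tmul, add_mul, map_add, hx, hy]
    | tmul p q => simp [tw₃_tmul, tw_tmul]
  induction T with
  | zero => simp
  | add x y hx hy => simp only [add_mul, map_add, hx, hy]
  | tmul x y =>
    rw [LinearMap.rTensor_tmul, ← key, ← act_mul, tw_tmul]
    simp

lemma preMul_assoc (s t r : A ⊗[k] H) :
    preMul k H A (preMul k H A s t) r = preMul k H A s (preMul k H A t r) := by
  induction s with
  | zero => simp
  | add x y hx hy => simp only [map_add, LinearMap.add_apply, hx, hy]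
  | tmul a h =>
  induction t with
  | zero => simp
  | add x y hx hy => simp only [map_add, LinearMap.add_apply, hx, hy]
  | tmul b g =>
  induction r with
  | zero => simp
  | add x y hx hy => simp only [map_add, hx, hy]
  | tmul c f =>
  have claim1 : ∀ T : H ⊗[k] H,
      preMul k H A ((a ⊗ₜ[k] (1 : H)) * tw k H A b T * ((1 : A) ⊗ₜ[k] g)) (c ⊗ₜ[k] f) =
      (a ⊗ₜ[k] (1 : H)) * tw₃ k H A b c (LinearMap.lTensor H (comul (R := k)) T *
        ((1 : H) ⊗ₜ[k] comul (R := k) g)) * ((1 : A) ⊗ₜ[k] f) := by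
    intro T
    induction T with
    | zero => simp
    | add x y hx hy => simp only [map_add, LinearMap.add_apply, add_mul, mul_add, hx, hy]
    | tmul p y =>
      rw [tw_tmul, Algebra.TensorProduct.tmul_mul_tmul, Algebra.TensorProduct.tmul_mul_tmul,
        preMul_tmul, LinearMap.lTensor_tmul, Algebra.TensorProduct.tmul_mul_tmul, tw₃_tmul]
      simp [comul_mul, ← mul_assoc]
  have claim2 : ∀ U : H ⊗[k] H,
      preMul k H A (a ⊗ₜ[k] h) ((b ⊗ₜ[k] (1 : H)) * tw k H A c U * ((1 : A) ⊗ₜ[k] f)) =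
      (a ⊗ₜ[k] (1 : H)) * tw₃ k H A b c (TensorProduct.assoc k H H H
        (LinearMap.rTensor H (comul (R := k)) (comul (R := k) h)) *
        ((1 : H) ⊗ₜ[k] U)) * ((1 : A) ⊗ₜ[k] f) := by
    intro U
    induction U with
    | zero => simp
    | add x y hx hy =>
      simp only [map_add, add_mul, mul_add, TensorProduct.tmul_add, hx, hy]
    | tmul u v =>
      rw [← act_mul_tmul k b c u v, tw_tmul, Algebra.TensorProduct.tmul_mul_tmul,
        Algebra.TensorProduct.tmul_mul_tmul, preMul_tmul]
      simp [mul_assoc]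
  rw [preMul_tmul, claim1, preMul_tmul, claim2, Coalgebra.coassoc_apply]

lemma act_of_mem_target {z : H} (hz : z ∈ target k H) (c : A) :
    act (k := k) z c = act (k := k) z 1 * c := by
  have key : ∀ T : H ⊗[k] H, LinearMap.mul' k A (TensorProduct.map
        ((act (k := k) (H := H) (A := A)).toLinearMap.flip 1)
        ((act (k := k) (H := H) (A := A)).toLinearMap.flip c) (T * (z ⊗ₜ[k] (1 : H)))) =
      LinearMap.mul' k A (TensorProduct.map
        ((act (k := k) (H := H) (A := A)).toLinearMap.flip (act (k := k) z 1))
        ((act (k := k) (H := H) (A := A)).toLinearMap.flip c) T) := by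
    intro T
    induction T with
    | zero => simp
    | add x y hx hy => simp only [map_add, add_mul, hx, hy]
    | tmul u v => simp
  have h1 := act_mul (k := k) z (1 : A) c
  rw [comul_of_mem_target' hz, key, ← act_mul, one_mul] at h1
  simpa using h1

lemma smashQuot_rel (a : A) {z : H} (hz : z ∈ target k H) (h : H) :
    smashQuot k H A ((a * act (k := k) z (1 : A)) ⊗ₜ[k] h) =
      smashQuot k H A (a ⊗ₜ[k] (z * h)) :=
  (Submodule.Quotient.eq _).2 (Submodule.subset_span ⟨a, h, z, hz, rfl⟩)

lemma smashQuot_tw_one (a : A) (T : H ⊗[k] H) (g : H) :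
    smashQuot k H A ((a ⊗ₜ[k] (1 : H)) * tw k H A 1 T * ((1 : A) ⊗ₜ[k] g)) =
      smashQuot k H A (a ⊗ₜ[k]
        (LinearMap.mul' k H (LinearMap.rTensor H (targetMap k) T) * g)) := by
  induction T with
  | zero => simp
  | add x y hx hy => simp only [map_add, add_mul, mul_add, TensorProduct.tmul_add, hx, hy]
  | tmul p q =>
    rw [tw_tmul, act_one, Algebra.TensorProduct.tmul_mul_tmul,
      Algebra.TensorProduct.tmul_mul_tmul, one_mul, mul_one,
      smashQuot_rel k _ (targetMap_mem_target p)]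
    simp [mul_assoc]

lemma preMul_smashRel_left {s : A ⊗[k] H} (hs : s ∈ smashRel k H A) (t : A ⊗[k] H) :
    preMul k H A s t = 0 := by
  induction hs using Submodule.span_induction with
  | zero => simp
  | add x y _ _ hx hy => simp [hx, hy]
  | smul c x _ hx => simp [hx]
  | mem s hs =>
  obtain ⟨a, h, z, hz, rfl⟩ := hs
  induction t with
  | zero => simp
  | add x y hx hy => rw [map_add, hx, hy, add_zero]
  | tmul b g =>
  have key : ∀ T : H ⊗[k] H, tw k H A b ((z ⊗ₜ[k] (1 : H)) * T) =
      ((act (k := k) z (1 : A)) ⊗ₜ[k] (1 : H)) * tw k H A b T := by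
    intro T
    induction T with
    | zero => simp
    | add x y hx hy => simp only [map_add, mul_add, hx, hy]
    | tmul x y => simp [tw_tmul, act_of_mem_target k hz (act (k := k) x b)]
  rw [map_sub, LinearMap.sub_apply, preMul_tmul, preMul_tmul, comul_mul,
    comul_of_mem_target hz, mul_assoc (z ⊗ₜ[k] (1 : H)), comul_one_mul, key, ← mul_assoc]
  simp

lemma preMul_smashRel_right (s : A ⊗[k] H) {t : A ⊗[k] H} (ht : t ∈ smashRel k H A) :
    smashQuot k H A (preMul k H A s t) = 0 := by
  induction ht using Submodule.span_induction with
  | zero => simp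
  | add x y _ _ hx hy => simp [hx, hy]
  | smul c x _ hx => simp [hx]
  | mem t ht =>
  obtain ⟨b, g, z, hz, rfl⟩ := ht
  induction s with
  | zero => simp
  | add x y hx hy => rw [map_add, LinearMap.add_apply, map_add, hx, hy, add_zero]
  | tmul a h =>
  have key : ∀ T : H ⊗[k] H,
      smashQuot k H A ((a ⊗ₜ[k] (1 : H)) * tw₃ k H A b 1 (LinearMap.lTensor H (comul (R := k)) T *
        ((1 : H) ⊗ₜ[k] (z ⊗ₜ[k] g)))) =
      smashQuot k H A ((a ⊗ₜ[k] (1 : H)) * tw k H A b T * ((1 : A) ⊗ₜ[k] (z * g))) := by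
    intro T
    induction T with
    | zero => simp
    | add x y hx hy => simp only [map_add, mul_add, add_mul, hx, hy]
    | tmul p y =>
      have h3 : comul (R := k) y * (z ⊗ₜ[k] g) =
          comul (R := k) (y * z) * ((1 : H) ⊗ₜ[k] g) := by
        rw [comul_mul, comul_of_mem_target' hz, ← mul_assoc (comul (R := k) y), comul_mul_one,
          mul_assoc]
        simp
      rw [LinearMap.lTensor_tmul, Algebra.TensorProduct.tmul_mul_tmul, tw₃_tmul, h3,
        tw_mul_one_tmul, ← mul_assoc, ← mul_assoc, Algebra.TensorProduct.tmul_mul_tmul,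
        mul_one (1 : H), mul_one p, smashQuot_tw_one, mul_rTensor_targetMap_comul, tw_tmul]
      simp [mul_assoc]
  rw [map_sub, map_sub, preMul_tmul, preMul_tmul, mul_assoc, act_mul_tmul k b 1 z g,
    Coalgebra.coassoc_apply, key, sub_self]

/-- The multiplication of the smash product as a bilinear map. -/
noncomputable def smashMul :
    SmashProduct k H A →ₗ[k] SmashProduct k H A →ₗ[k] SmashProduct k H A :=
  (Submodule.liftQ (smashRel k H A)
    (Submodule.liftQ (smashRel k H A) ((preMul k H A).compr₂ (smashQuot k H A))
      (fun s hs => LinearMap.ext fun t => by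
        simp [preMul_smashRel_left k hs])).flip
    (fun t ht => LinearMap.ext fun x => by
      obtain ⟨s, rfl⟩ := Submodule.mkQ_surjective _ x
      exact preMul_smashRel_right k s ht)).flip

lemma smashMul_quot (s t : A ⊗[k] H) :
    smashMul k (smashQuot k H A s) (smashQuot k H A t) = smashQuot k H A (preMul k H A s t) :=
  rfl

lemma smashQuot_surjective : Function.Surjective (smashQuot k H A) :=
  Submodule.mkQ_surjective _

lemma smashMul_assoc (x y z : SmashProduct k H A) :
    smashMul k (smashMul k x y) z = smashMul k x (smashMul k y z) := by
  obtain ⟨x, rfl⟩ := smashQuot_surjective k x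
  obtain ⟨y, rfl⟩ := smashQuot_surjective k y
  obtain ⟨z, rfl⟩ := smashQuot_surjective k z
  simp only [smashMul_quot, preMul_assoc]

lemma one_smashMul (x : SmashProduct k H A) :
    smashMul k (smash k (1 : A) (1 : H)) x = x := by
  obtain ⟨x, rfl⟩ := smashQuot_surjective k x
  rw [smash, smashMul_quot]
  induction x with
  | zero => simp
  | add x y hx hy => simp only [map_add, hx, hy]
  | tmul b g =>
  have key : ∀ T : H ⊗[k] H,
      smashQuot k H A (tw k H A b (LinearMap.lTensor H (targetMap k) T) * ((1 : A) ⊗ₜ[k] g)) =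
      smashQuot k H A ((LinearMap.mul' k A (TensorProduct.map
        ((act (k := k) (H := H) (A := A)).toLinearMap.flip b)
        ((act (k := k) (H := H) (A := A)).toLinearMap.flip 1)
        (LinearMap.lTensor H (targetMap k) T))) ⊗ₜ[k] g) := by
    intro T
    induction T with
    | zero => simp
    | add x y hx hy => simp only [map_add, add_mul, TensorProduct.add_tmul, hx, hy]
    | tmul p q =>
      simp [tw_tmul, smashQuot_rel k _ (targetMap_mem_target q)]
  have h1 := key (comul (R := k) 1)
  rw [lTensor_targetMap_comul_one, ← act_mul] at h1
  rw [preMul_tmul, ← Algebra.TensorProduct.one_def, one_mul, h1]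
  simp

lemma smashMul_one (x : SmashProduct k H A) :
    smashMul k x (smash k (1 : A) (1 : H)) = x := by
  obtain ⟨x, rfl⟩ := smashQuot_surjective k x
  rw [smash, smashMul_quot]
  induction x with
  | zero => simp
  | add x y hx hy => simp only [map_add, LinearMap.add_apply, hx, hy]
  | tmul a h =>
    rw [preMul_tmul, smashQuot_tw_one, mul_rTensor_targetMap_comul, mul_one]

/-- The smash product is an associative ring with unit `1 # 1`. -/
noncomputable instance : Ring (SmashProduct k H A) where
  __ := (inferInstance : AddCommGroup (SmashProduct k H A))
  mul x y := smashMul k x y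
  one := smash k (1 : A) (1 : H)
  left_distrib x y z := map_add (smashMul k x) y z
  right_distrib x y z := by
    show smashMul k (x + y) z = smashMul k x z + smashMul k y z
    rw [map_add, LinearMap.add_apply]
  zero_mul x := by
    show smashMul k 0 x = 0
    rw [map_zero, LinearMap.zero_apply]
  mul_zero x := map_zero (smashMul k x)
  mul_assoc := smashMul_assoc k
  one_mul := one_smashMul k
  mul_one := smashMul_one k

/-- The smash product is a `k`-algebra. -/
noncomputable instance : Algebra k (SmashProduct k H A) :=
  Algebra.ofModule
    (fun c x y => by
      show smashMul k (c • x) y = c • smashMul k x y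
      rw [map_smul, LinearMap.smul_apply])
    (fun c x y => map_smul (smashMul k x) c y)

/-- `(a # h)(b # g) = a (h₁ · b) # h₂ g` -/
lemma smash_mul_smash (a b : A) (h g : H) :
    smash k a h * smash k b g = smashQuot k H A
      ((a ⊗ₜ[k] (1 : H)) * LinearMap.rTensor H
        ((act (k := k) (H := H) (A := A)).toLinearMap.flip b) (comul (R := k) h) *
        ((1 : A) ⊗ₜ[k] g)) := by
  show smashQuot k H A (preMul k H A (a ⊗ₜ[k] h) (b ⊗ₜ[k] g)) = _
  rw [preMul_tmul]
  rfl

/-- `1 = 1 # 1` -/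
lemma smash_one_one : smash k (1 : A) (1 : H) = 1 := rfl

end Smash

end WeakHopfAlgebra

/-! # Separability elements -/

section Separability

variable (k : Type*) {U : Type*} [Field k] [Ring U] [Algebra k U]

/-- `f = f¹ ⊗ f² ∈ U ⊗ U` is a symmetric separability element: `u f = f u` for all `u ∈ U` (for the
outer bimodule structure), `f¹ f² = 1`, and `f` is fixed by the flip. -/
structure IsSymmetricSeparabilityElement (f : U ⊗[k] U) : Prop where
  casimir : ∀ u : U, (u ⊗ₜ[k] (1 : U)) * f = f * ((1 : U) ⊗ₜ[k] u)
  mul_eq_one : LinearMap.mul' k U f = 1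
  symm : TensorProduct.comm k U U f = f

variable (U) in
/-- A `k`-algebra is Kanzaki separable if it has a symmetric separability element. -/
def KanzakiSeparable : Prop := ∃ f : U ⊗[k] U, IsSymmetricSeparabilityElement k f

end Separability

/-! # Markov extensions and the Jones tower -/

section Tower

variable {k N M : Type*} [Field k] [Ring N] [Algebra k N] [Ring M] [Algebra k M]

/-- The centralizer `C_M(N)` of the image of `ι : N → M`. -/
def centralizerOf (ι : N →ₐ[k] M) : Subalgebra k M := Subalgebra.centralizer k (Set.range ι)

/-- The algebra `End(M_N)` of right `N`-linear endomorphisms of `M`. -/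
def basicSubalgebra (ι : N →ₐ[k] M) : Subalgebra k (Module.End k M) where
  carrier := {f | ∀ (x : M) (n : N), f (x * ι n) = f x * ι n}
  mul_mem' {f g} hf hg x n := by
    simp only [Set.mem_ofPred_eq] at hf hg
    simp [hf, hg]
  add_mem' {f g} hf hg x n := by
    simp only [Set.mem_ofPred_eq] at hf hg
    simp [hf, hg, add_mul]
  algebraMap_mem' c x n := by simp [Module.algebraMap_end_apply]

/-- The basic construction `End(M_N)` of an extension `ι : N → M`. -/
def BasicConstruction (ι : N →ₐ[k] M) : Type _ := basicSubalgebra ι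

namespace BasicConstruction

instance (ι : N →ₐ[k] M) : Ring (BasicConstruction ι) :=
  inferInstanceAs (Ring (basicSubalgebra ι))

instance (ι : N →ₐ[k] M) : Algebra k (BasicConstruction ι) :=
  inferInstanceAs (Algebra k (basicSubalgebra ι))

/-- The elements of `End(M_N)` as `k`-linear maps. -/
def toEnd (ι : N →ₐ[k] M) : BasicConstruction ι →ₐ[k] Module.End k M := (basicSubalgebra ι).val

variable {ι : N →ₐ[k] M}

lemma toEnd_mul_apply (f : BasicConstruction ι) (x : M) (n : N) :
    toEnd ι f (x * ι n) = toEnd ι f x * ι n := f.2 x n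

lemma ext' {f g : BasicConstruction ι} (h : ∀ x, toEnd ι f x = toEnd ι g x) : f = g :=
  Subtype.ext (LinearMap.ext h)

end BasicConstruction

open BasicConstruction (toEnd)

/-- The inclusion `M → End(M_N)` by left multiplications. -/
def leftRegular (ι : N →ₐ[k] M) : M →ₐ[k] BasicConstruction ι :=
  (Algebra.lmul k M).codRestrict (basicSubalgebra ι) fun m x n => by simp [mul_assoc]

lemma leftRegular_apply (ι : N →ₐ[k] M) (m x : M) : toEnd ι (leftRegular ι m) x = m * x := rfl

/-- For `N → M → M₁ = End(M_N)`, the centralizer `C_{M₁}(N)`. -/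
def secondCentralizer (ι : N →ₐ[k] M) : Subalgebra k (BasicConstruction ι) :=
  centralizerOf ((leftRegular ι).comp ι)

/-- Dual bases `x_i, y_i` for a map `E : M → N`: `∑ E(m x_i) y_i = m = ∑ x_i E(y_i m)`. -/
def IsDualBases (ι : N →ₐ[k] M) (E : M →ₗ[k] N) {n : ℕ} (x y : Fin n → M) : Prop :=
  ∀ m : M, ∑ i, ι (E (m * x i)) * y i = m ∧ ∑ i, x i * ι (E (y i * m)) = m

/-- A Markov extension `M/N` of `k`-algebras: a Frobenius extension with Frobenius coordinates
`E, x_i, y_i` such that `E(1) = 1` and `∑ x_i y_i = lam⁻¹ 1` with `lam ∈ k` nonzero, together with a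
trace `T : N → k` such that `T(1) = 1` and `T ∘ E` is a trace on `M`. (Injectivity of `N → M`
follows from `E(1) = 1`.) -/
structure MarkovExtension (ι : N →ₐ[k] M) where
  /-- The conditional expectation. -/
  E : M →ₗ[k] N
  E_left : ∀ (n : N) (m : M), E (ι n * m) = n * E m
  E_right : ∀ (m : M) (n : N), E (m * ι n) = E m * n
  /-- The number of elements of the dual bases. -/
  size : ℕ
  /-- The first dual basis. -/
  x : Fin size → M
  /-- The second dual basis. -/
  y : Fin size → M
  dual : IsDualBases ι E x y
  E_one : E 1 = 1
  /-- The reciprocal of the index. -/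
  lam : k
  lam_ne_zero : lam ≠ 0
  index : ∑ i, x i * y i = lam⁻¹ • (1 : M)
  /-- The Markov trace. -/
  T : N →ₗ[k] k
  T_mul_comm : ∀ a b : N, T (a * b) = T (b * a)
  T_one : T 1 = 1
  T_E_mul_comm : ∀ a b : M, T (E (a * b)) = T (E (b * a))

namespace MarkovExtension

variable {ι : N →ₐ[k] M} (P : MarkovExtension ι)

/-- The trace `T ∘ E` on `M`. -/
def T₀ : M →ₗ[k] k := P.T ∘ₗ P.E

lemma E_incl (n : N) : P.E (ι n) = n := by
  have h := P.E_left n 1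
  rwa [mul_one, P.E_one, mul_one] at h

/-- The Jones idempotent: `E`, as an endomorphism of `M`. -/
def jones : BasicConstruction ι :=
  ⟨ι.toLinearMap ∘ₗ P.E, fun x n => by simp [P.E_right]⟩

lemma jones_apply (m : M) : toEnd ι P.jones m = ι (P.E m) := rfl

/-- The conditional expectation `End(M_N) → M`; it maps `m e m'` to `lam • (m m')`, where `e` is the
Jones idempotent. -/
def condExp : BasicConstruction ι →ₗ[k] M where
  toFun f := P.lam • ∑ i, toEnd ι f (P.x i) * P.y i
  map_add' f g := by simp [add_mul, Finset.sum_add_distrib]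
  map_smul' c f := by simp [← Finset.smul_sum, smul_comm c P.lam]

lemma condExp_apply (f : BasicConstruction ι) :
    P.condExp f = P.lam • ∑ i, toEnd ι f (P.x i) * P.y i := rfl

lemma apply_eq_sum (f : BasicConstruction ι) (m : M) :
    toEnd ι f m = ∑ i, toEnd ι f (P.x i) * ι (P.E (P.y i * m)) := by
  conv_lhs => rw [← (P.dual m).2]
  rw [map_sum]
  exact Finset.sum_congr rfl fun i _ => BasicConstruction.toEnd_mul_apply f _ _

lemma condExp_mul_jones_mul (m m' : M) :
    P.condExp (leftRegular ι m * P.jones * leftRegular ι m') = P.lam • (m * m') := by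
  rw [condExp_apply]
  conv_rhs => rw [← (P.dual m').1, Finset.mul_sum]
  simp [leftRegular_apply, jones_apply, mul_assoc]

lemma condExp_mul_left (m : M) (f : BasicConstruction ι) :
    P.condExp (leftRegular ι m * f) = m * P.condExp f := by
  simp [condExp_apply, leftRegular_apply, Finset.mul_sum, mul_assoc]

lemma condExp_mul_right (f : BasicConstruction ι) (m : M) :
    P.condExp (f * leftRegular ι m) = P.condExp f * m := by
  simp only [condExp_apply, smul_mul_assoc, Finset.sum_mul]
  congr 1
  calc ∑ i, toEnd ι (f * leftRegular ι m) (P.x i) * P.y i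
      = ∑ i, ∑ j, toEnd ι f (P.x j) * ι (P.E (P.y j * m * P.x i)) * P.y i := by
        refine Finset.sum_congr rfl fun i _ => ?_
        show toEnd ι f (m * P.x i) * P.y i = _
        rw [P.apply_eq_sum f, Finset.sum_mul]
        simp [mul_assoc]
    _ = ∑ j, toEnd ι f (P.x j) * P.y j * m := by
        rw [Finset.sum_comm]
        refine Finset.sum_congr rfl fun j _ => ?_
        conv_rhs => rw [mul_assoc, ← (P.dual (P.y j * m)).1, Finset.mul_sum]
        simp [mul_assoc]

lemma condExp_one : P.condExp 1 = 1 := by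
  have : P.condExp 1 = P.lam • ∑ i, P.x i * P.y i := rfl
  rw [this, P.index, smul_smul, mul_inv_cancel₀ P.lam_ne_zero, one_smul]

lemma T₀_condExp_mul (f g : BasicConstruction ι) : P.T₀ (P.condExp (f * g)) =
    P.lam * ∑ i, ∑ j, P.T (P.E (P.y i * toEnd ι f (P.x j)) * P.E (P.y j * toEnd ι g (P.x i))) := by
  have h : P.condExp (f * g) = P.lam • ∑ i, toEnd ι f (toEnd ι g (P.x i)) * P.y i := rfl
  rw [h, map_smul, smul_eq_mul, map_sum]
  congr 1
  refine Finset.sum_congr rfl fun i _ => ?_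
  rw [P.apply_eq_sum f (toEnd ι g (P.x i)), Finset.sum_mul, map_sum]
  refine Finset.sum_congr rfl fun j _ => ?_
  show P.T (P.E _) = _
  rw [P.T_E_mul_comm, ← mul_assoc, P.E_right]

/-- The extension `M₁/M`, where `M₁ = End(M_N)`, as a Markov extension. -/
def next : MarkovExtension (leftRegular ι) where
  E := P.condExp
  E_left := P.condExp_mul_left
  E_right := P.condExp_mul_right
  size := P.size
  x i := P.lam⁻¹ • (leftRegular ι (P.x i) * P.jones)
  y i := P.jones * leftRegular ι (P.y i)
  dual F := by
    constructor
    · have h : ∀ i, P.condExp (F * (P.lam⁻¹ • (leftRegular ι (P.x i) * P.jones))) =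
          toEnd ι F (P.x i) := by
        intro i
        rw [mul_smul_comm, map_smul, condExp_apply, smul_smul, inv_mul_cancel₀ P.lam_ne_zero,
          one_smul]
        have h1 := (P.dual 1).1
        simp only [one_mul] at h1
        calc _ = ∑ j, toEnd ι F (P.x i * ι (P.E (P.x j))) * P.y j := rfl
          _ = toEnd ι F (P.x i) * ∑ j, ι (P.E (P.x j)) * P.y j := by
            rw [Finset.mul_sum]
            exact Finset.sum_congr rfl fun j _ => by
              rw [BasicConstruction.toEnd_mul_apply, mul_assoc]
          _ = _ := by rw [h1, mul_one]
      simp only [h]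
      refine BasicConstruction.ext' fun m => ?_
      rw [P.apply_eq_sum F m]
      simp [leftRegular_apply, jones_apply]
    · refine BasicConstruction.ext' fun m => ?_
      have h : ∀ i, P.E (P.condExp (P.jones * leftRegular ι (P.y i) * F) * m) =
          P.lam • ∑ j, P.E (P.y i * toEnd ι F (P.x j)) * P.E (P.y j * m) := by
        intro i
        have : P.condExp (P.jones * leftRegular ι (P.y i) * F) =
          P.lam • ∑ j, ι (P.E (P.y i * toEnd ι F (P.x j))) * P.y j := rfl
        rw [this, smul_mul_assoc, map_smul, Finset.sum_mul, map_sum]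
        simp only [mul_assoc, P.E_left]
      have h2 : toEnd ι (∑ i, P.lam⁻¹ • (leftRegular ι (P.x i) * P.jones) *
          leftRegular ι (P.condExp (P.jones * leftRegular ι (P.y i) * F))) m =
          ∑ i, P.lam⁻¹ • (P.x i *
            ι (P.E (P.condExp (P.jones * leftRegular ι (P.y i) * F) * m))) := by
        simp [leftRegular_apply, jones_apply]
      rw [h2, P.apply_eq_sum F m]
      simp only [h, map_smul, mul_smul_comm, smul_smul, inv_mul_cancel₀ P.lam_ne_zero, one_smul,
        map_sum, map_mul, Finset.mul_sum]
      rw [Finset.sum_comm]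
      refine Finset.sum_congr rfl fun j _ => ?_
      conv_rhs => rw [← (P.dual (toEnd ι F (P.x j))).2, Finset.sum_mul]
      simp [mul_assoc]
  E_one := P.condExp_one
  lam := P.lam
  lam_ne_zero := P.lam_ne_zero
  index := by
    refine BasicConstruction.ext' fun m => ?_
    have h : toEnd ι (∑ i, P.lam⁻¹ • (leftRegular ι (P.x i) * P.jones) *
        (P.jones * leftRegular ι (P.y i))) m =
        ∑ i, P.lam⁻¹ • (P.x i * ι (P.E (ι (P.E (P.y i * m))))) := by
      simp [leftRegular_apply, jones_apply]
    rw [h]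
    simp only [P.E_incl, ← Finset.smul_sum, (P.dual m).2]
    rfl
  T := P.T₀
  T_mul_comm := P.T_E_mul_comm
  T_one := by
    show P.T (P.E 1) = 1
    rw [P.E_one, P.T_one]
  T_E_mul_comm f g := by
    rw [T₀_condExp_mul, T₀_condExp_mul, Finset.sum_comm]
    simp only [P.T_mul_comm]

/-- The Markov extension is symmetric: `E(ux) = E(xu)` for all `u ∈ C_M(N)` and `x ∈ M`. -/
def IsSymmetric : Prop := ∀ u ∈ centralizerOf ι, ∀ x : M, P.E (u * x) = P.E (x * u)

/-- The symmetric product condition `∑ y_i x_i = lam⁻¹ 1` (and `∑ x_i y_i = lam⁻¹ 1`, which holds in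
every Markov extension). -/
def SymmetricProduct : Prop := ∑ i, P.y i * P.x i = P.lam⁻¹ • (1 : M)

/-- The alternative to the symmetric product condition: `T₁ ∘ φ = T₀` on `U = C_M(N)`, where
`φ(u) = ∑ x_i u e₁ y_i` and `T₁ = T ∘ E ∘ E_M`. -/
def TracePreserving : Prop := ∀ u ∈ centralizerOf ι,
  P.next.T₀ (∑ i, leftRegular ι (P.x i * u) * P.jones * leftRegular ι (P.y i)) = P.T₀ u

/-- Weak irreducibility: `U = C_M(N)` is Kanzaki separable, and the restriction of the trace
`T₀ = T ∘ E` to `U` is non-degenerate. -/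
def WeaklyIrreducible : Prop :=
  KanzakiSeparable k (centralizerOf ι) ∧
    ∀ u ∈ centralizerOf ι, (∀ v ∈ centralizerOf ι, P.T₀ (u * v) = 0) → u = 0

/-- `E` has dual bases in the subalgebra `C` of `M`. -/
def HasDualBasesIn (C : Subalgebra k M) : Prop :=
  ∃ (n : ℕ) (z w : Fin n → M), (∀ i, z i ∈ C) ∧ (∀ i, w i ∈ C) ∧ IsDualBases ι P.E z w

/-- The (weak) depth 2 property: `E_M : M₁ → M` has dual bases in `A = C_{M₁}(N)`, and
`E_{M₁} : M₂ → M₁` has dual bases in `B = C_{M₂}(M)`. -/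
def DepthTwo : Prop :=
  P.next.HasDualBasesIn (secondCentralizer ι) ∧
    P.next.next.HasDualBasesIn (secondCentralizer (leftRegular ι))

/-- For `w ∈ M₁` and `a ∈ M₁`, the functional `b ↦ ⟨a, b⟩ = lam⁻² T₂(a e₂ e₁ w b)` on
`B = C_{M₂}(M)`. -/
def pairing (w a : BasicConstruction ι) : secondCentralizer (leftRegular ι) →ₗ[k] k :=
  (P.lam⁻¹ ^ 2) • (P.next.next.T₀ ∘ₗ
    LinearMap.mulLeft k (leftRegular (leftRegular ι) a * P.next.jones *
      leftRegular (leftRegular ι) P.jones * leftRegular (leftRegular ι) w) ∘ₗ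
    (secondCentralizer (leftRegular ι)).val.toLinearMap)

/-- For `w ∈ M₁` and `a ∈ M₁`, the functional `b ↦ ⟨a, b⟩' = lam⁻² T₂(b e₁ e₂ w a)` on
`B = C_{M₂}(M)`. -/
def pairing' (w a : BasicConstruction ι) : secondCentralizer (leftRegular ι) →ₗ[k] k :=
  (P.lam⁻¹ ^ 2) • (P.next.next.T₀ ∘ₗ
    LinearMap.mulRight k (leftRegular (leftRegular ι) P.jones * P.next.jones *
      leftRegular (leftRegular ι) w * leftRegular (leftRegular ι) a) ∘ₗ
    (secondCentralizer (leftRegular ι)).val.toLinearMap)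

/-- The element `f¹ T(f²)` of `V = C_{M₁}(M)`, for `f = f¹ ⊗ f² ∈ V ⊗ V`, where `T` is the
restriction of `T₁ = T ∘ E ∘ E_M`. -/
noncomputable def contract
    (f : centralizerOf (leftRegular ι) ⊗[k] centralizerOf (leftRegular ι)) :
    centralizerOf (leftRegular ι) :=
  TensorProduct.rid k _ (LinearMap.lTensor _
    (P.next.T₀ ∘ₗ (centralizerOf (leftRegular ι)).val.toLinearMap) f)

end MarkovExtension

end Tower

/-! Put `R = M` and `S = M₁`, so that `M₂ = End(S_R)`. Then `B` consists of the `R`-bimodule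
endomorphisms of `S`, and `b ▷ x` is the value `b(x)`. The weak Hopf algebra and the smash product
are built for any extension `R → S` with the data of `WeakHopfCoordinates`; the tower enters only in
supplying these data and in the pairing.

Let `p_i, q_i ∈ B` be dual bases of `E : End(S_R) → S`. The comultiplication `Δ(b) = ∑ E(b · p_i) ⊗
q_i` satisfies `b x = b₁(x) b₂` in `End(S_R)`, hence `b(xy) = b₁(x) b₂(y)`. A separability element
`∑ s ⊗ t` of `V = C_S(R)` can be inserted between `p_i` and `q_i`, and `Δ(1)` is `∑ (right mult. by
s) ⊗ (left mult. by t)`. An element of `B ⊗ B` fixed by left multiplication by `Δ(1)` is determined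
by the maps `p ⊗ q ↦ p(x) q` (`comul_one_mul_congr`, `eq_comul`). Multiplicativity and
coassociativity thus become identities between endomorphisms. The counit is a trace form on `V`
applied to `b(1)`, the antipode is the adjoint for `(x, y) ↦ E(wxy)`, and the expansion `c = ∑ E(c
p_i) q_i` inverts the map `x # b ↦ xb` (`smashMap_bijective`).

In the tower, right multiplications identify `V` with the opposite of `U`, and `T₁` with `T₀`. A
symmetric separability element is dual to a non-degenerate trace up to a central unit
(`exists_dual`), which produces `w`. Non-degeneracy on `U` also yields the commutation of `B` under
`E_M E_{M₁}` (`condExp_next_condExp_comm`), and everything assembles in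
`exists_weakHopfCoordinates`. Finally `⟨a, b⟩ = λ⁻¹ T₁(b(a) e₁ w)` turns the statements on the
pairing into statements on values of bimodule maps. -/

open BasicConstruction (toEnd)

/-! ### Bimodule endomorphisms and the convolution `E(b · c)` -/

section SecondCentralizer

variable {k R S : Type*} [Field k] [Ring R] [Algebra k R] [Ring S] [Algebra k S]
  {j : R →ₐ[k] S}

lemma mem_centralizerOf_iff {v : S} : v ∈ centralizerOf j ↔ ∀ r, j r * v = v * j r := by
  simp [centralizerOf, Subalgebra.mem_centralizer_iff]

lemma centralizerOf_comm (v : centralizerOf j) (r : R) : j r * v.1 = v.1 * j r :=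
  mem_centralizerOf_iff.1 v.2 r

/-- Right linearity is built into `End(S_R)`, so commuting with left multiplications by `R` leaves
exactly the bimodule endomorphisms. Elements of `B` are handled in this form throughout. -/
lemma mem_secondCentralizer_iff {b : BasicConstruction j} : b ∈ secondCentralizer j ↔
    ∀ r x, toEnd j b (j r * x) = j r * toEnd j b x := by
  rw [secondCentralizer, mem_centralizerOf_iff]
  constructor
  · intro h r x
    exact (congrArg (fun g => toEnd j g x) (h r)).symm
  · intro h r
    exact BasicConstruction.ext' fun x => (h r x).symm

namespace SecondCentralizer

variable (j) in
/-- The tautological action of `C_{End(S_R)}(R)` on `S`. -/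
def eval : secondCentralizer j →ₐ[k] Module.End k S :=
  (toEnd j).comp (secondCentralizer j).val

lemma eval_apply (b : secondCentralizer j) (x : S) : eval j b x = toEnd j b.1 x := rfl

lemma eval_mul_apply (b c : secondCentralizer j) (x : S) :
    eval j (b * c) x = eval j b (eval j c x) := by
  rw [map_mul, Module.End.mul_apply]

lemma eval_left (b : secondCentralizer j) (r : R) (x : S) :
    eval j b (j r * x) = j r * eval j b x :=
  mem_secondCentralizer_iff.1 b.2 r x

lemma eval_right (b : secondCentralizer j) (x : S) (r : R) :
    eval j b (x * j r) = eval j b x * j r :=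
  BasicConstruction.toEnd_mul_apply b.1 x r

lemma ext {b c : secondCentralizer j} (h : ∀ x, eval j b x = eval j c x) : b = c :=
  Subtype.ext (BasicConstruction.ext' h)

/-- An `R`-bimodule endomorphism of `S` as an element of `C_{End(S_R)}(R)`. -/
def ofLinear (g : Module.End k S) (hl : ∀ r x, g (j r * x) = j r * g x)
    (hr : ∀ x r, g (x * j r) = g x * j r) : secondCentralizer j :=
  ⟨⟨g, hr⟩, mem_secondCentralizer_iff.2 hl⟩

lemma eval_ofLinear (g : Module.End k S) (hl : ∀ r x, g (j r * x) = j r * g x)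
    (hr : ∀ x r, g (x * j r) = g x * j r) (x : S) : eval j (ofLinear g hl hr) x = g x := rfl

lemma eval_mem_centralizer (b : secondCentralizer j) (v : centralizerOf j) :
    eval j b v.1 ∈ centralizerOf j :=
  mem_centralizerOf_iff.2 fun r => by
    rw [← eval_left, centralizerOf_comm, eval_right]

variable (j) in
/-- Left multiplications by elements of the centralizer. -/
def left : centralizerOf j →ₐ[k] secondCentralizer j :=
  ((leftRegular j).comp (centralizerOf j).val).codRestrict _ fun v =>
    mem_secondCentralizer_iff.2 fun r x => by
      show v.1 * (j r * x) = j r * (v.1 * x)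
      rw [← mul_assoc, ← centralizerOf_comm, mul_assoc]

lemma eval_left_apply (v : centralizerOf j) (x : S) : eval j (left j v) x = v.1 * x := rfl

lemma left_val (v : centralizerOf j) : (left j v).1 = leftRegular j v.1 := rfl

variable (j) in
/-- Right multiplications by elements of the centralizer. -/
def right : centralizerOf j →ₗ[k] secondCentralizer j where
  toFun v := ofLinear (LinearMap.mulRight k v.1) (fun r x => by simp [mul_assoc])
    (fun x r => by simp [mul_assoc, centralizerOf_comm])
  map_add' v w := ext fun x => mul_add x v.1 w.1
  map_smul' c v := ext fun x => mul_smul_comm c x v.1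

lemma eval_right_apply (v : centralizerOf j) (x : S) : eval j (right j v) x = x * v.1 := rfl

/-- The value of an element of `C_{End(S_R)}(R)` at an element of the centralizer. -/
def evalCentralizer (v : centralizerOf j) : secondCentralizer j →ₗ[k] centralizerOf j :=
  LinearMap.codRestrict (Subalgebra.toSubmodule (centralizerOf j))
    ((eval j).toLinearMap.flip v.1) fun b => eval_mem_centralizer b v

lemma evalCentralizer_val (v : centralizerOf j) (b : secondCentralizer j) :
    (evalCentralizer v b).1 = eval j b v.1 := rfl

lemma val_mul_leftRegular (b : secondCentralizer j) (r : R) :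
    b.1 * leftRegular j (j r) = leftRegular j (j r) * b.1 :=
  (mem_centralizerOf_iff.1 b.2 r).symm

/-- The linear map `p ⊗ q ↦ p(x) q ∈ End(S_R)`. -/
def evalMul (x : S) :
    secondCentralizer j ⊗[k] secondCentralizer j →ₗ[k] BasicConstruction j :=
  LinearMap.mul' k (BasicConstruction j) ∘ₗ TensorProduct.map
    ((leftRegular j).toLinearMap ∘ₗ (eval j).toLinearMap.flip x)
    (secondCentralizer j).val.toLinearMap

lemma evalMul_tmul (x : S) (p q : secondCentralizer j) :
    evalMul x (p ⊗ₜ[k] q) = leftRegular j (eval j p x) * q.1 := rfl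

end SecondCentralizer

namespace MarkovExtension

open SecondCentralizer

variable (Q : MarkovExtension j)

/-- The restriction `C_{End(S_R)}(R) → C_S(R)` of the conditional expectation. -/
def condExpCentralizer : secondCentralizer j →ₗ[k] centralizerOf j :=
  LinearMap.codRestrict (Subalgebra.toSubmodule (centralizerOf j))
    (Q.condExp ∘ₗ (secondCentralizer j).val.toLinearMap) fun b =>
      mem_centralizerOf_iff.2 fun r => by
        show j r * Q.condExp b.1 = Q.condExp b.1 * j r
        rw [← Q.condExp_mul_left, ← Q.condExp_mul_right, val_mul_leftRegular]

lemma condExpCentralizer_val (b : secondCentralizer j) :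
    (Q.condExpCentralizer b).1 = Q.condExp b.1 := rfl

lemma condExpCentralizer_mul_left (b : secondCentralizer j) (v : centralizerOf j) :
    Q.condExpCentralizer (b * left j v) = Q.condExpCentralizer b * v :=
  Subtype.ext (Q.condExp_mul_right b.1 v.1)

/-- The bilinear map sending `(b, c)` to the endomorphism `x ↦ E(b x c)`. -/
def conv : secondCentralizer j →ₗ[k] secondCentralizer j →ₗ[k] secondCentralizer j :=
  LinearMap.mk₂ k
    (fun b c => ofLinear
      (Q.condExp ∘ₗ LinearMap.mulRight k c.1 ∘ₗ LinearMap.mulLeft k b.1 ∘ₗ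
        (leftRegular j).toLinearMap)
      (fun r x => by
        show Q.condExp (b.1 * leftRegular j (j r * x) * c.1) =
          j r * Q.condExp (b.1 * leftRegular j x * c.1)
        rw [map_mul (leftRegular j), ← mul_assoc, val_mul_leftRegular, ← Q.condExp_mul_left]
        simp only [mul_assoc])
      (fun x r => by
        show Q.condExp (b.1 * leftRegular j (x * j r) * c.1) =
          Q.condExp (b.1 * leftRegular j x * c.1) * j r
        rw [map_mul (leftRegular j), ← mul_assoc, mul_assoc, ← val_mul_leftRegular,
          ← Q.condExp_mul_right]
        simp only [mul_assoc]))
    (fun b b' c => SecondCentralizer.ext fun x => by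
      show Q.condExp ((b.1 + b'.1) * leftRegular j x * c.1) = Q.condExp _ + Q.condExp _
      rw [add_mul, add_mul, map_add]; rfl)
    (fun a b c => SecondCentralizer.ext fun x => by
      show Q.condExp ((a • b.1) * leftRegular j x * c.1) = a • Q.condExp _
      rw [smul_mul_assoc, smul_mul_assoc, map_smul]; rfl)
    (fun b c c' => SecondCentralizer.ext fun x => by
      show Q.condExp (b.1 * leftRegular j x * (c.1 + c'.1)) = Q.condExp _ + Q.condExp _
      rw [mul_add, map_add]; rfl)
    (fun a b c => SecondCentralizer.ext fun x => by
      show Q.condExp (b.1 * leftRegular j x * (a • c.1)) = a • Q.condExp _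
      rw [mul_smul_comm, map_smul]; rfl)

lemma eval_conv (b c : secondCentralizer j) (x : S) :
    eval j (Q.conv b c) x = Q.condExp (b.1 * leftRegular j x * c.1) := rfl

/-- Since `E` is right `S`-linear, a factor `v` at the end of the second argument comes out as a
right multiplication. With `conv_left_mul` this explains why the legs of `Δ(1)` are right and left
multiplications. -/
lemma conv_mul_left (b c : secondCentralizer j) (v : centralizerOf j) :
    Q.conv b (c * left j v) = right j v * Q.conv b c :=
  SecondCentralizer.ext fun x => by
    rw [eval_mul_apply, eval_right_apply, eval_conv, eval_conv, ← Q.condExp_mul_right, mul_assoc]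
    rfl

lemma conv_left_mul (b c : secondCentralizer j) (v : centralizerOf j) :
    Q.conv (left j v * b) c = left j v * Q.conv b c :=
  SecondCentralizer.ext fun x => by
    rw [eval_mul_apply, eval_left_apply, eval_conv, eval_conv, ← Q.condExp_mul_left]
    simp only [mul_assoc]
    rfl

lemma conv_one (c : secondCentralizer j) :
    Q.conv 1 c = right j (Q.condExpCentralizer c) :=
  SecondCentralizer.ext fun x => by
    rw [eval_right_apply, eval_conv, condExpCentralizer_val, ← Q.condExp_mul_left]
    simp

end MarkovExtension

end SecondCentralizer

/-! ### Coordinates and the comultiplication -/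

section WeakHopf

variable {k R S : Type*} [Field k] [Ring R] [Algebra k R] [Ring S] [Algebra k S]
  {j : R →ₐ[k] S}

open SecondCentralizer

/-- Coordinates for the weak Hopf algebra structure on `C_{End(S_R)}(R)`: a symmetric separability
element `∑ s ⊗ t` of `V = C_S(R)` which is dual to the functional `v ↦ T₀(w v)` with `w` central and
invertible, and dual bases `p, q` of the conditional expectation in `C_{End(S_R)}(R)`, symmetric up
to `w`. -/
structure WeakHopfCoordinates (Q : MarkovExtension j) where
  m : ℕ
  s : Fin m → centralizerOf j
  t : Fin m → centralizerOf j
  casimir : ∀ v, ∑ l, (v * s l) ⊗ₜ[k] t l = ∑ l, s l ⊗ₜ[k] (t l * v)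
  sum_mul : ∑ l, s l * t l = 1
  symm : ∑ l, t l ⊗ₜ[k] s l = ∑ l, s l ⊗ₜ[k] t l
  w : centralizerOf j
  z : centralizerOf j
  w_mul_z : w * z = 1
  z_mul_w : z * w = 1
  w_comm : ∀ v, w * v = v * w
  sum_weight : ∀ v : centralizerOf j, ∑ l, Q.T₀ (w.1 * ((t l).1 * v.1)) • s l = v
  κ : Type
  [fintype : Fintype κ]
  p : κ → secondCentralizer j
  q : κ → secondCentralizer j
  sum_condExp_mul : ∀ c : BasicConstruction j,
    ∑ i, leftRegular j (Q.condExp (c * (p i).1)) * (q i).1 = c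
  sum_mul_condExp : ∀ c : BasicConstruction j,
    ∑ i, (p i).1 * leftRegular j (Q.condExp ((q i).1 * c)) = c
  sum_sep : ∑ i, ∑ l, (p i * left j (s l)) ⊗ₜ[k] (left j (t l) * q i) = ∑ i, p i ⊗ₜ[k] q i
  sum_symm : ∑ i, q i ⊗ₜ[k] (p i * left j w) = ∑ i, (p i * left j w) ⊗ₜ[k] q i
  E_comm : ∀ (v : centralizerOf j) (x : S), Q.E (v.1 * x) = Q.E (x * v.1)
  condExp_comm : ∀ (b : secondCentralizer j) (c : BasicConstruction j),
    Q.E (Q.condExp (b.1 * c)) = Q.E (Q.condExp (c * b.1))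

namespace WeakHopfCoordinates

attribute [instance] WeakHopfCoordinates.fintype

variable {Q : MarkovExtension j} (D : WeakHopfCoordinates Q)

/-- The functional `v ↦ T₀(w v)` on `C_S(R)`. -/
def weight : centralizerOf j →ₗ[k] k :=
  Q.T₀ ∘ₗ LinearMap.mulLeft k D.w.1 ∘ₗ (centralizerOf j).val.toLinearMap

lemma weight_apply (v : centralizerOf j) : D.weight v = Q.T₀ (D.w.1 * v.1) := rfl

lemma weight_comm (u v : centralizerOf j) : D.weight (u * v) = D.weight (v * u) := by
  have h : D.w * (u * v) = u * (D.w * v) := by rw [← mul_assoc, D.w_comm, mul_assoc]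
  have h2 : D.w * (v * u) = (D.w * v) * u := by rw [mul_assoc]
  rw [weight_apply, weight_apply]
  calc Q.T₀ (D.w.1 * (u.1 * v.1)) = Q.T₀ (u.1 * (D.w.1 * v.1)) :=
        congrArg (fun a : centralizerOf j => Q.T₀ a.1) h
    _ = Q.T₀ ((D.w.1 * v.1) * u.1) := Q.T_E_mul_comm _ _
    _ = _ := by rw [mul_assoc]; rfl

lemma sum_weight_mul (v : centralizerOf j) : ∑ l, D.weight (D.t l * v) • D.s l = v :=
  D.sum_weight v

lemma casimir_lift {X : Type*} [AddCommGroup X] [Module k X]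
    (F : centralizerOf j →ₗ[k] centralizerOf j →ₗ[k] X) (v : centralizerOf j) :
    ∑ l, F (v * D.s l) (D.t l) = ∑ l, F (D.s l) (D.t l * v) := by
  simpa only [map_sum, TensorProduct.lift.tmul] using
    congrArg (TensorProduct.lift F) (D.casimir v)

lemma symm_lift {X : Type*} [AddCommGroup X] [Module k X]
    (F : centralizerOf j →ₗ[k] centralizerOf j →ₗ[k] X) :
    ∑ l, F (D.t l) (D.s l) = ∑ l, F (D.s l) (D.t l) := by
  simpa only [map_sum, TensorProduct.lift.tmul] using congrArg (TensorProduct.lift F) D.symm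

/-- The device behind most computations below: the separability element is inserted between the dual
bases, and then absorbed by the Casimir identity or by its duality with the weight. -/
lemma sep_lift {X : Type*} [AddCommGroup X] [Module k X]
    (F : secondCentralizer j →ₗ[k] secondCentralizer j →ₗ[k] X) :
    ∑ i, ∑ l, F (D.p i * left j (D.s l)) (left j (D.t l) * D.q i) = ∑ i, F (D.p i) (D.q i) := by
  simpa only [map_sum, TensorProduct.lift.tmul] using congrArg (TensorProduct.lift F) D.sum_sep

lemma sum_symm_lift {X : Type*} [AddCommGroup X] [Module k X]
    (F : secondCentralizer j →ₗ[k] secondCentralizer j →ₗ[k] X) :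
    ∑ i, F (D.q i) (D.p i * left j D.w) = ∑ i, F (D.p i * left j D.w) (D.q i) := by
  simpa only [map_sum, TensorProduct.lift.tmul] using congrArg (TensorProduct.lift F) D.sum_symm

lemma sum_weight_mul' (v : centralizerOf j) : ∑ l, D.weight (v * D.s l) • D.t l = v := by
  have h := D.symm_lift (LinearMap.mk₂ k (fun a b => D.weight (v * a) • b)
    (fun a b c => by rw [mul_add, map_add, add_smul])
    (fun r a c => by rw [mul_smul_comm, map_smul, smul_assoc])
    (fun a b c => smul_add _ _ _) (fun r a c => smul_comm _ _ _))
  simp only [LinearMap.mk₂_apply] at h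
  rw [← h]
  simp only [D.weight_comm v, D.sum_weight_mul]

lemma sum_condExpCentralizer_mul (b : secondCentralizer j) :
    ∑ i, left j (Q.condExpCentralizer (b * D.p i)) * D.q i = b :=
  Subtype.ext (by
    rw [AddSubmonoidClass.coe_finsetSum]
    exact D.sum_condExp_mul b.1)

/-- The comultiplication. -/
noncomputable def comul :
    secondCentralizer j →ₗ[k] secondCentralizer j ⊗[k] secondCentralizer j :=
  ∑ i, (TensorProduct.mk k _ _).flip (D.q i) ∘ₗ Q.conv.flip (D.p i)

lemma comul_apply (b : secondCentralizer j) :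
    D.comul b = ∑ i, Q.conv b (D.p i) ⊗ₜ[k] D.q i := by
  simp [comul, LinearMap.sum_apply]

/-- The counit. -/
def counit : secondCentralizer j →ₗ[k] k := D.weight ∘ₗ evalCentralizer 1

lemma counit_apply (b : secondCentralizer j) : D.counit b = D.weight (evalCentralizer 1 b) := rfl

/-- After inserting the separability element, the Casimir identity carries `E(p_i)` from the first
leg to the second, where `∑ E(p_i) q_i = 1`. -/
lemma comul_one_eq : D.comul 1 = ∑ l, right j (D.s l) ⊗ₜ[k] left j (D.t l) := by
  rw [comul_apply]
  have h := D.sep_lift ((TensorProduct.mk k (secondCentralizer j) (secondCentralizer j)).comp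
    (right j ∘ₗ Q.condExpCentralizer))
  simp only [LinearMap.comp_apply, TensorProduct.mk_apply] at h
  simp only [Q.conv_one]
  rw [← h]
  have h2 : ∀ i, ∑ l, right j (Q.condExpCentralizer (D.p i) * D.s l) ⊗ₜ[k]
      (left j (D.t l) * D.q i) =
      ∑ l, right j (D.s l) ⊗ₜ[k] (left j (D.t l) *
        (left j (Q.condExpCentralizer (D.p i)) * D.q i)) := by
    intro i
    have := D.casimir_lift ((TensorProduct.mk k (secondCentralizer j) (secondCentralizer j)).compl₁₂
      (right j) (LinearMap.mulRight k (D.q i) ∘ₗ (left j).toLinearMap))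
      (Q.condExpCentralizer (D.p i))
    simpa [mul_assoc] using this
  simp only [Q.condExpCentralizer_mul_left, h2]
  rw [Finset.sum_comm]
  refine Finset.sum_congr rfl fun l _ => ?_
  rw [← TensorProduct.tmul_sum, ← Finset.mul_sum]
  have := D.sum_condExpCentralizer_mul 1
  simp only [one_mul] at this
  rw [this, mul_one]

/-- The coefficient of `q i` in `Δ(1) T`. -/
noncomputable def coeff (i : D.κ) :
    secondCentralizer j ⊗[k] secondCentralizer j →ₗ[k] secondCentralizer j :=
  TensorProduct.lift (((LinearMap.mul k (secondCentralizer j)).flip).compl₂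
    (right j ∘ₗ Q.condExpCentralizer ∘ₗ LinearMap.mulRight k (D.p i)))

lemma coeff_tmul (i : D.κ) (b c : secondCentralizer j) :
    D.coeff i (b ⊗ₜ[k] c) = right j (Q.condExpCentralizer (c * D.p i)) * b := rfl

/-- The coefficients of `Δ(1) T` see `T` only through the elements `evalMul x T`; hence these
determine `Δ(1) T`. -/
lemma eval_coeff (i : D.κ) (T : secondCentralizer j ⊗[k] secondCentralizer j) (x : S) :
    eval j (D.coeff i T) x = Q.condExp (evalMul x T * (D.p i).1) := by
  induction T with
  | zero => simp
  | add T U hT hU => simp only [map_add, LinearMap.add_apply, add_mul, hT, hU]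
  | tmul b c =>
    rw [coeff_tmul, eval_mul_apply, eval_right_apply, evalMul_tmul, mul_assoc,
      Q.condExp_mul_left]
    rfl

lemma left_mul_right (u v : centralizerOf j) : left j u * right j v = right j v * left j u :=
  SecondCentralizer.ext fun x => by
    simp only [eval_mul_apply, eval_right_apply, eval_left_apply, mul_assoc]

lemma comul_one_mul_eq (T : secondCentralizer j ⊗[k] secondCentralizer j) :
    D.comul 1 * T = ∑ i, D.coeff i T ⊗ₜ[k] D.q i := by
  induction T with
  | zero => simp
  | add T U hT hU =>
    simp only [map_add, mul_add, hT, hU, TensorProduct.add_tmul, Finset.sum_add_distrib]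
  | tmul b c =>
  have h := D.sep_lift ((TensorProduct.mk k (secondCentralizer j) (secondCentralizer j)).comp
    (LinearMap.mulRight k b ∘ₗ right j ∘ₗ Q.condExpCentralizer ∘ₗ LinearMap.mulLeft k c))
  simp only [LinearMap.comp_apply, TensorProduct.mk_apply, LinearMap.mulRight_apply,
    LinearMap.mulLeft_apply] at h
  simp only [coeff_tmul]
  rw [← h, comul_one_eq, Finset.sum_mul]
  have h2 : ∀ i, ∑ l, (right j (Q.condExpCentralizer (c * D.p i) * D.s l) * b) ⊗ₜ[k]
      (left j (D.t l) * D.q i) =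
      ∑ l, (right j (D.s l) * b) ⊗ₜ[k] (left j (D.t l) *
        (left j (Q.condExpCentralizer (c * D.p i)) * D.q i)) := by
    intro i
    have := D.casimir_lift ((TensorProduct.mk k (secondCentralizer j) (secondCentralizer j)).compl₁₂
      (LinearMap.mulRight k b ∘ₗ right j) (LinearMap.mulRight k (D.q i) ∘ₗ (left j).toLinearMap))
      (Q.condExpCentralizer (c * D.p i))
    simpa [mul_assoc] using this
  simp only [← mul_assoc c, Q.condExpCentralizer_mul_left, h2]
  rw [Finset.sum_comm]
  refine Finset.sum_congr rfl fun l _ => ?_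
  rw [← TensorProduct.tmul_sum, ← Finset.mul_sum, D.sum_condExpCentralizer_mul,
    Algebra.TensorProduct.tmul_mul_tmul]

lemma comul_one_mul_congr {T U : secondCentralizer j ⊗[k] secondCentralizer j}
    (h : ∀ x, evalMul x T = evalMul x U) : D.comul 1 * T = D.comul 1 * U := by
  rw [comul_one_mul_eq, comul_one_mul_eq]
  refine Finset.sum_congr rfl fun i _ => ?_
  congr 1
  exact SecondCentralizer.ext fun x => by rw [eval_coeff, eval_coeff, h]

/-- The defining property `b₁(x) b₂ = b x` of the comultiplication is the dual basis expansion of `b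
x ∈ End(S_R)`. -/
lemma evalMul_comul (x : S) (b : secondCentralizer j) :
    evalMul x (D.comul b) = b.1 * leftRegular j x := by
  rw [comul_apply, map_sum]
  simp only [evalMul_tmul, Q.eval_conv]
  exact D.sum_condExp_mul _

lemma comul_one_mul (b : secondCentralizer j) : D.comul 1 * D.comul b = D.comul b := by
  rw [comul_one_mul_eq, D.comul_apply b]
  refine Finset.sum_congr rfl fun i _ => ?_
  congr 1
  exact SecondCentralizer.ext fun x => by
    rw [eval_coeff, ← D.comul_apply b, evalMul_comul, Q.eval_conv]

lemma evalMul_comul_mul (x : S) (b : secondCentralizer j)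
    (T : secondCentralizer j ⊗[k] secondCentralizer j) :
    evalMul x (D.comul b * T) = b.1 * evalMul x T := by
  induction T with
  | zero => simp
  | add T U hT hU => simp only [mul_add, map_add, hT, hU]
  | tmul p q =>
    have : ∀ U : secondCentralizer j ⊗[k] secondCentralizer j,
        evalMul x (U * (p ⊗ₜ[k] q)) = evalMul (eval j p x) U * q.1 := by
      intro U
      induction U with
      | zero => simp
      | add T U hT hU => simp only [add_mul, map_add, hT, hU]
      | tmul b c =>
        rw [Algebra.TensorProduct.tmul_mul_tmul, evalMul_tmul, evalMul_tmul, eval_mul_apply,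
          mul_assoc]
        rfl
    rw [this, evalMul_comul, evalMul_tmul, mul_assoc]

lemma comul_mul (b c : secondCentralizer j) : D.comul (b * c) = D.comul b * D.comul c := by
  rw [← D.comul_one_mul (b * c), ← D.comul_one_mul b, mul_assoc]
  -- Both sides act as `b c x`, because `Δ(b)` acts on products by composition with `b`.
  refine D.comul_one_mul_congr fun x => ?_
  rw [evalMul_comul_mul, evalMul_comul, evalMul_comul, ← mul_assoc]
  rfl

/-- An element of `B ⊗ B` is `Δ(b)` if it is fixed by `Δ(1)` and acts on products as `b`. -/
lemma eq_comul {T : secondCentralizer j ⊗[k] secondCentralizer j} {b : secondCentralizer j}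
    (h1 : D.comul 1 * T = T) (h2 : ∀ x, evalMul x T = b.1 * leftRegular j x) :
    T = D.comul b := by
  rw [← h1, ← D.comul_one_mul b]
  exact D.comul_one_mul_congr fun x => by rw [h2, evalMul_comul]

/-- Lets coassociativity be read off: both iterated comultiplications become sums of `conv b p ⊗
conv q p' ⊗ q'`. -/
lemma comul_conv (b c : secondCentralizer j) :
    D.comul (Q.conv b c) = ∑ i, Q.conv b (D.p i) ⊗ₜ[k] Q.conv (D.q i) c := by
  symm
  refine D.eq_comul ?_ fun x => ?_
  -- Inserting the separability element on the right-hand side produces exactly a left factor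
  -- `Δ(1)`.
  · have h := D.sep_lift ((TensorProduct.mk k (secondCentralizer j) (secondCentralizer j)).compl₁₂
      (Q.conv b) (Q.conv.flip c))
    simp only [LinearMap.compl₁₂_apply, TensorProduct.mk_apply, LinearMap.flip_apply] at h
    conv_rhs => rw [← h]
    rw [comul_one_eq, Finset.sum_mul, Finset.sum_comm]
    refine Finset.sum_congr rfl fun l _ => ?_
    rw [Finset.mul_sum]
    refine Finset.sum_congr rfl fun i _ => ?_
    rw [Algebra.TensorProduct.tmul_mul_tmul, Q.conv_mul_left, Q.conv_left_mul]
  · refine BasicConstruction.ext' fun y => ?_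
    rw [map_sum, map_sum, LinearMap.sum_apply]
    have h : ∀ i, toEnd j (evalMul x (Q.conv b (D.p i) ⊗ₜ[k] Q.conv (D.q i) c)) y =
        Q.condExp (leftRegular j (Q.condExp (b.1 * leftRegular j x * (D.p i).1)) * (D.q i).1 *
          (leftRegular j y * c.1)) := by
      intro i
      rw [mul_assoc, Q.condExp_mul_left, ← mul_assoc (D.q i).1]
      rfl
    simp only [h]
    rw [← map_sum, ← Finset.sum_mul, D.sum_condExp_mul]
    show _ = Q.condExp (b.1 * leftRegular j (x * y) * c.1)
    rw [map_mul (leftRegular j)]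
    simp only [mul_assoc]

lemma coassoc :
    (TensorProduct.assoc k _ _ _).toLinearMap ∘ₗ D.comul.rTensor (secondCentralizer j) ∘ₗ D.comul =
      D.comul.lTensor (secondCentralizer j) ∘ₗ D.comul := by
  ext b
  simp only [LinearMap.comp_apply, D.comul_apply b, map_sum, LinearMap.rTensor_tmul,
    LinearMap.lTensor_tmul, comul_conv, LinearEquiv.coe_coe]
  simp only [comul_apply, TensorProduct.sum_tmul, map_sum, TensorProduct.tmul_sum,
    TensorProduct.assoc_tmul]
  rw [Finset.sum_comm]

end WeakHopfCoordinates

end WeakHopf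

/-! ### Counit and the weak bialgebra axioms -/

lemma TensorProduct.assoc_symm_tmul_sum {k A B C κ : Type*} [Field k] [AddCommGroup A]
    [AddCommGroup B] [AddCommGroup C] [Module k A] [Module k B] [Module k C] [Fintype κ] (a : A)
    (b : κ → B) (c : κ → C) :
    (TensorProduct.assoc k A B C).symm (a ⊗ₜ[k] ∑ i, b i ⊗ₜ[k] c i) =
      ∑ i, (a ⊗ₜ[k] b i) ⊗ₜ[k] c i := by
  simp [TensorProduct.tmul_sum]

section WeakHopf

variable {k R S : Type*} [Field k] [Ring R] [Algebra k R] [Ring S] [Algebra k S]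
  {j : R →ₐ[k] S}

open SecondCentralizer

namespace WeakHopfCoordinates

variable {Q : MarkovExtension j} (D : WeakHopfCoordinates Q)

lemma counit_left_mul (v : centralizerOf j) (b : secondCentralizer j) :
    D.counit (left j v * b) = D.weight (v * evalCentralizer 1 b) := rfl

lemma counit_right_mul (v : centralizerOf j) (b : secondCentralizer j) :
    D.counit (right j v * b) = D.weight (evalCentralizer 1 b * v) := rfl

lemma sum_eval_conv_mul_eval (b : secondCentralizer j) (x y : S) :
    ∑ i, eval j (Q.conv b (D.p i)) x * eval j (D.q i) y = eval j b (x * y) := by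
  have h := congrArg (fun c => toEnd j c y) (D.evalMul_comul x b)
  simpa [comul_apply, evalMul_tmul, leftRegular_apply, eval_apply, LinearMap.sum_apply] using h

/-- The value of `conv b p_i` at `1` is `E(b p_i)`. Applying the weight and the dual bases of `V`
recovers it as a left factor of `q_i`, and `∑ E(b p_i) q_i = b`. -/
lemma sum_counit_smul (b : secondCentralizer j) :
    ∑ i, D.counit (Q.conv b (D.p i)) • D.q i = b := by
  have h := D.sep_lift ((LinearMap.lsmul k (secondCentralizer j) ∘ₗ D.counit) ∘ₗ Q.conv b)
  simp only [LinearMap.comp_apply, LinearMap.lsmul_apply,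
    Q.conv_mul_left, counit_right_mul] at h
  rw [← h]
  conv_rhs => rw [← D.sum_condExpCentralizer_mul b]
  refine Finset.sum_congr rfl fun i _ => ?_
  have h2 : evalCentralizer 1 (Q.conv b (D.p i)) = Q.condExpCentralizer (b * D.p i) :=
    Subtype.ext (by
      rw [evalCentralizer_val, Q.eval_conv, Q.condExpCentralizer_val, OneMemClass.coe_one, map_one,
        mul_one]
      rfl)
  rw [h2]
  conv_rhs => rw [← D.sum_weight_mul' (Q.condExpCentralizer (b * D.p i)), map_sum, Finset.sum_mul]
  simp only [map_smul, smul_mul_assoc]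

/-- Here the dual bases of `V` recover right multiplication by `q_i(1)`, and the identity becomes
`b(x · 1) = b₁(x) b₂(1)`. -/
lemma sum_counit_smul' (b : secondCentralizer j) :
    ∑ i, D.counit (D.q i) • Q.conv b (D.p i) = b := by
  have h := D.sep_lift (((LinearMap.lsmul k (secondCentralizer j) ∘ₗ D.counit).flip) ∘ₗ
    Q.conv b)
  simp only [LinearMap.comp_apply, LinearMap.lsmul_apply,
    Q.conv_mul_left, counit_left_mul, LinearMap.flip_apply] at h
  rw [← h]
  have h2 : ∀ i, ∑ l, D.weight (D.t l * evalCentralizer 1 (D.q i)) •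
      (right j (D.s l) * Q.conv b (D.p i)) =
      right j (evalCentralizer 1 (D.q i)) * Q.conv b (D.p i) := by
    intro i
    conv_rhs => rw [← D.sum_weight_mul (evalCentralizer 1 (D.q i)), map_sum, Finset.sum_mul]
    simp only [map_smul, smul_mul_assoc]
  simp only [h2]
  refine SecondCentralizer.ext fun x => ?_
  rw [map_sum, LinearMap.sum_apply]
  conv_rhs => rw [← mul_one x, ← D.sum_eval_conv_mul_eval]
  rfl

/-- Both sides are the weight of `h(g(f(1)))`: on the right the argument of `g` is factored as `1 ·
f(1)`, and the product `g₁(1) g₂(f(1))` is split by the dual bases of `V`. -/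
lemma counit_mul_mul (h g f : secondCentralizer j) : D.counit (h * g * f) =
    LinearMap.mul' k k (TensorProduct.map (D.counit ∘ₗ LinearMap.mulLeft k h)
      (D.counit ∘ₗ LinearMap.mulRight k f) (D.comul g)) := by
  have h1 := D.sep_lift ((LinearMap.mul k k).compl₁₂ (D.counit ∘ₗ LinearMap.mulLeft k h ∘ₗ Q.conv g)
    (D.counit ∘ₗ LinearMap.mulRight k f))
  simp only [LinearMap.compl₁₂_apply, LinearMap.comp_apply, LinearMap.mulLeft_apply,
    LinearMap.mulRight_apply, Q.conv_mul_left, mul_assoc (left j _), counit_left_mul,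
    LinearMap.mul_apply'] at h1
  rw [comul_apply]
  simp only [map_sum, TensorProduct.map_tmul, LinearMap.mul'_apply, LinearMap.comp_apply,
    LinearMap.mulLeft_apply, LinearMap.mulRight_apply]
  rw [← h1]
  have h2 : ∀ i, ∑ l, D.counit (h * (right j (D.s l) * Q.conv g (D.p i))) *
      D.weight (D.t l * evalCentralizer 1 (D.q i * f)) =
      D.counit (h * (right j (evalCentralizer 1 (D.q i * f)) * Q.conv g (D.p i))) := by
    intro i
    conv_rhs => rw [← D.sum_weight_mul (evalCentralizer 1 (D.q i * f))]
    simp only [map_sum, Finset.sum_mul, Finset.mul_sum, map_smul, smul_mul_assoc, mul_smul_comm,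
      smul_eq_mul]
    exact Finset.sum_congr rfl fun l _ => mul_comm _ _
  simp only [h2]
  rw [← map_sum, ← Finset.mul_sum, counit_apply, counit_apply]
  congr 1
  refine Subtype.ext ?_
  rw [evalCentralizer_val, evalCentralizer_val, mul_assoc, eval_mul_apply, eval_mul_apply h]
  congr 1
  rw [map_sum, LinearMap.sum_apply, eval_mul_apply]
  conv_lhs => rw [← one_mul (eval j f _), ← D.sum_eval_conv_mul_eval]
  exact Finset.sum_congr rfl fun i _ => rfl

/-- The same computation with the factorization `f(1) · 1`, so that the legs of `Δ(g)` exchange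
their roles. -/
lemma counit_mul_mul' (h g f : secondCentralizer j) : D.counit (h * g * f) =
    LinearMap.mul' k k (TensorProduct.map (D.counit ∘ₗ LinearMap.mulRight k f)
      (D.counit ∘ₗ LinearMap.mulLeft k h) (D.comul g)) := by
  have h1 := D.sep_lift ((LinearMap.mul k k).compl₁₂
    (D.counit ∘ₗ LinearMap.mulRight k f ∘ₗ Q.conv g) (D.counit ∘ₗ LinearMap.mulLeft k h))
  simp only [LinearMap.compl₁₂_apply, LinearMap.comp_apply, LinearMap.mulLeft_apply,
    LinearMap.mulRight_apply, Q.conv_mul_left, mul_assoc (right j _), counit_right_mul,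
    LinearMap.mul_apply'] at h1
  rw [comul_apply]
  simp only [map_sum, TensorProduct.map_tmul, LinearMap.mul'_apply, LinearMap.comp_apply,
    LinearMap.mulLeft_apply, LinearMap.mulRight_apply]
  rw [← h1]
  have h2 : ∀ i, ∑ l, D.weight (evalCentralizer 1 (Q.conv g (D.p i) * f) * D.s l) *
      D.counit (h * (left j (D.t l) * D.q i)) =
      D.counit (h * (left j (evalCentralizer 1 (Q.conv g (D.p i) * f)) * D.q i)) := by
    intro i
    conv_rhs => rw [← D.sum_weight_mul' (evalCentralizer 1 (Q.conv g (D.p i) * f))]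
    simp only [map_sum, Finset.sum_mul, Finset.mul_sum, map_smul, smul_mul_assoc, mul_smul_comm,
      smul_eq_mul]
  simp only [h2]
  rw [← map_sum, ← Finset.mul_sum, counit_apply, counit_apply]
  congr 1
  refine Subtype.ext ?_
  rw [evalCentralizer_val, evalCentralizer_val, mul_assoc, eval_mul_apply, eval_mul_apply h]
  congr 1
  rw [map_sum, LinearMap.sum_apply, eval_mul_apply]
  conv_lhs => rw [← mul_one (eval j f _), ← D.sum_eval_conv_mul_eval]
  exact Finset.sum_congr rfl fun i _ => rfl

/-- The second leg of `Δ(1)` consists of left multiplications, which commute with right ones. This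
is why both forms of the unit axiom hold. -/
lemma one_tmul_right_mul_comul_one (v : centralizerOf j) :
    ((1 : secondCentralizer j) ⊗ₜ[k] right j v) * D.comul 1 =
      D.comul 1 * ((1 : secondCentralizer j) ⊗ₜ[k] right j v) := by
  rw [comul_one_eq, Finset.mul_sum, Finset.sum_mul]
  refine Finset.sum_congr rfl fun l _ => ?_
  rw [Algebra.TensorProduct.tmul_mul_tmul, Algebra.TensorProduct.tmul_mul_tmul, left_mul_right,
    one_mul, mul_one]

/-- By `eq_comul` this reduces to `(xy)v = x(yv)`. -/
lemma comul_right (v : centralizerOf j) :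
    D.comul (right j v) = D.comul 1 * ((1 : secondCentralizer j) ⊗ₜ[k] right j v) := by
  symm
  refine D.eq_comul ?_ fun x => ?_
  · rw [← mul_assoc, ← comul_mul, mul_one]
  · rw [evalMul_comul_mul, evalMul_tmul, map_one]
    refine BasicConstruction.ext' fun y => ?_
    exact (mul_assoc x y v.1).symm

lemma rTensor_comul_comul_one : D.comul.rTensor (secondCentralizer j) (D.comul 1) =
    (D.comul 1 ⊗ₜ[k] (1 : secondCentralizer j)) *
      (TensorProduct.assoc k _ _ _).symm ((1 : secondCentralizer j) ⊗ₜ[k] D.comul 1) := by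
  have h : (TensorProduct.assoc k _ _ _).symm ((1 : secondCentralizer j) ⊗ₜ[k] D.comul 1) =
      ∑ l, ((1 : secondCentralizer j) ⊗ₜ[k] right j (D.s l)) ⊗ₜ[k] left j (D.t l) := by
    rw [comul_one_eq, TensorProduct.assoc_symm_tmul_sum]
  rw [h]
  conv_lhs => rw [comul_one_eq, map_sum]
  rw [Finset.mul_sum]
  refine Finset.sum_congr rfl fun l _ => ?_
  rw [LinearMap.rTensor_tmul, Algebra.TensorProduct.tmul_mul_tmul, one_mul, comul_right]

lemma rTensor_comul_comul_one' : D.comul.rTensor (secondCentralizer j) (D.comul 1) =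
    (TensorProduct.assoc k _ _ _).symm ((1 : secondCentralizer j) ⊗ₜ[k] D.comul 1) *
      (D.comul 1 ⊗ₜ[k] (1 : secondCentralizer j)) := by
  have h : (TensorProduct.assoc k _ _ _).symm ((1 : secondCentralizer j) ⊗ₜ[k] D.comul 1) =
      ∑ l, ((1 : secondCentralizer j) ⊗ₜ[k] right j (D.s l)) ⊗ₜ[k] left j (D.t l) := by
    rw [comul_one_eq, TensorProduct.assoc_symm_tmul_sum]
  rw [h]
  conv_lhs => rw [comul_one_eq, map_sum]
  rw [Finset.sum_mul]
  refine Finset.sum_congr rfl fun l _ => ?_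
  rw [LinearMap.rTensor_tmul, Algebra.TensorProduct.tmul_mul_tmul, mul_one, comul_right,
    one_tmul_right_mul_comul_one]

/-! ### The antipode as an adjoint -/

/-- The map `x ↦ E(w x)`. -/
def weightedE : S →ₗ[k] R := Q.E ∘ₗ LinearMap.mulLeft k D.w.1

lemma weightedE_apply (x : S) : D.weightedE x = Q.E (D.w.1 * x) := rfl

lemma weightedE_left (r : R) (x : S) : D.weightedE (j r * x) = r * D.weightedE x := by
  rw [weightedE_apply, weightedE_apply, ← mul_assoc, ← centralizerOf_comm, mul_assoc, Q.E_left]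

lemma weightedE_right (x : S) (r : R) : D.weightedE (x * j r) = D.weightedE x * r := by
  rw [weightedE_apply, weightedE_apply, ← mul_assoc, Q.E_right]

lemma w_val_comm (v : centralizerOf j) : D.w.1 * v.1 = v.1 * D.w.1 :=
  congrArg Subtype.val (D.w_comm v)

lemma w_val_mul_z (x : S) : D.w.1 * (D.z.1 * x) = x := by
  rw [← mul_assoc, ← MulMemClass.coe_mul, D.w_mul_z, OneMemClass.coe_one, one_mul]

lemma weightedE_comm (v : centralizerOf j) (x : S) :
    D.weightedE (v.1 * x) = D.weightedE (x * v.1) := by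
  rw [weightedE_apply, weightedE_apply, ← mul_assoc, w_val_comm, mul_assoc, D.E_comm, mul_assoc]

lemma weightedE_z_mul (x : S) : D.weightedE (D.z.1 * x) = Q.E x := by
  rw [weightedE_apply, w_val_mul_z]

lemma eq_of_weightedE_mul_left {y y' : S} (h : ∀ x, D.weightedE (x * y) = D.weightedE (x * y')) :
    y = y' := by
  rw [← (Q.dual y).2, ← (Q.dual y').2]
  refine Finset.sum_congr rfl fun i _ => ?_
  rw [← D.weightedE_z_mul, ← D.weightedE_z_mul, ← mul_assoc, ← mul_assoc, h]

lemma eq_of_weightedE_mul_right {x x' : S} (h : ∀ y, D.weightedE (x * y) = D.weightedE (x' * y)) :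
    x = x' := by
  rw [← (Q.dual x).1, ← (Q.dual x').1]
  refine Finset.sum_congr rfl fun i _ => ?_
  rw [← D.weightedE_z_mul, ← D.weightedE_z_mul, D.weightedE_comm, D.weightedE_comm, mul_assoc,
    mul_assoc, h]

lemma sum_weightedE_mul (x : S) :
    ∑ i, j (D.weightedE (x * Q.x i)) * (D.z.1 * Q.y i) = x := by
  have h : ∀ i, j (D.weightedE (x * Q.x i)) * (D.z.1 * Q.y i) =
      D.z.1 * (j (Q.E (D.w.1 * x * Q.x i)) * Q.y i) := by
    intro i
    rw [← mul_assoc, centralizerOf_comm, mul_assoc, weightedE_apply, mul_assoc]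
  simp only [h]
  rw [← Finset.mul_sum, (Q.dual _).1, ← mul_assoc, ← MulMemClass.coe_mul, D.z_mul_w,
    OneMemClass.coe_one, one_mul]

/-- The adjoint of `b` with respect to `(x, y) ↦ E(w x y)`, as a linear map. -/
def adjoint (b : secondCentralizer j) : Module.End k S :=
  ∑ i, LinearMap.mulLeft k (Q.x i) ∘ₗ j.toLinearMap ∘ₗ D.weightedE ∘ₗ
    LinearMap.mulLeft k (eval j b (D.z.1 * Q.y i))

lemma weightedE_mul_adjoint (b : secondCentralizer j) (x y : S) :
    D.weightedE (x * D.adjoint b y) = D.weightedE (eval j b x * y) := by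
  conv_rhs => rw [← D.sum_weightedE_mul x]
  simp only [adjoint, LinearMap.sum_apply, LinearMap.comp_apply, LinearMap.mulLeft_apply,
    AlgHom.toLinearMap_apply, Finset.mul_sum, map_sum, Finset.sum_mul]
  refine Finset.sum_congr rfl fun i _ => ?_
  rw [← mul_assoc, weightedE_right, eval_left, mul_assoc, weightedE_left]

/-- The antipode. -/
def antipode : secondCentralizer j →ₗ[k] secondCentralizer j where
  toFun b := ofLinear (D.adjoint b)
    -- The form `(t, y) ↦ E(wty)` is non-degenerate, so bilinearity properties of the adjoint are
    -- checked against all `t`.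
    (fun r x => D.eq_of_weightedE_mul_left fun t => by
      rw [weightedE_mul_adjoint, ← mul_assoc, ← mul_assoc, weightedE_mul_adjoint, eval_right])
    (fun x r => D.eq_of_weightedE_mul_left fun t => by
      rw [weightedE_mul_adjoint, ← mul_assoc, ← mul_assoc, weightedE_right, weightedE_right,
        weightedE_mul_adjoint])
  map_add' b c := SecondCentralizer.ext fun x => D.eq_of_weightedE_mul_left fun t => by
    show D.weightedE (t * D.adjoint (b + c) x) =
      D.weightedE (t * (D.adjoint b x + D.adjoint c x))
    rw [mul_add, map_add]
    simp only [weightedE_mul_adjoint, map_add, LinearMap.add_apply, add_mul]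
  map_smul' a b := SecondCentralizer.ext fun x => D.eq_of_weightedE_mul_left fun t => by
    show D.weightedE (t * D.adjoint (a • b) x) = D.weightedE (t * (a • D.adjoint b x))
    rw [mul_smul_comm, map_smul]
    simp only [weightedE_mul_adjoint, map_smul, LinearMap.smul_apply,
      smul_mul_assoc]

lemma weightedE_mul_antipode (b : secondCentralizer j) (x y : S) :
    D.weightedE (x * eval j (D.antipode b) y) = D.weightedE (eval j b x * y) :=
  D.weightedE_mul_adjoint b x y

lemma antipode_injective : Function.Injective D.antipode := fun b c h =>
  SecondCentralizer.ext fun x => D.eq_of_weightedE_mul_right fun y => by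
    rw [← weightedE_mul_antipode, h, weightedE_mul_antipode]

/-- The commutation rule `condExp_comm` moves `c` cyclically to the front; the factor `z` cancels
the `w` in the form. -/
lemma weightedE_eval_conv_mul (b c : secondCentralizer j) (t y : S) :
    D.weightedE (t * eval j (Q.conv b c) y) =
      D.weightedE (D.z.1 * Q.condExp (c.1 * leftRegular j (D.w.1 * t) * b.1) * y) := by
  rw [mul_assoc, weightedE_z_mul, weightedE_apply, Q.eval_conv, ← mul_assoc, ← Q.condExp_mul_left,
    ← Q.condExp_mul_right, ← mul_assoc, ← D.condExp_comm]
  simp only [mul_assoc]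

/-- The dual basis expansion with the roles of `p` and `q` exchanged. The tensor `∑ p_i w ⊗ q_i` is
symmetric, and `w z = 1` removes the weight. -/
lemma sum_q_z_condExp (c : BasicConstruction j) :
    ∑ i, (D.q i).1 * leftRegular j (D.z.1 * Q.condExp ((D.p i).1 * leftRegular j D.w.1 * c)) =
      c := by
  have h := D.sum_symm_lift ((LinearMap.mul k (BasicConstruction j)).compl₁₂
    (secondCentralizer j).val.toLinearMap
    ((leftRegular j).toLinearMap ∘ₗ LinearMap.mulLeft k D.z.1 ∘ₗ Q.condExp ∘ₗ
      LinearMap.mulRight k c ∘ₗ (secondCentralizer j).val.toLinearMap))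
  simp only [LinearMap.compl₁₂_apply, LinearMap.comp_apply, LinearMap.mul_apply',
    AlgHom.toLinearMap_apply, LinearMap.mulLeft_apply, LinearMap.mulRight_apply,
    Subalgebra.val_apply, MulMemClass.coe_mul, left_val] at h
  rw [h]
  conv_rhs => rw [← D.sum_mul_condExp c]
  refine Finset.sum_congr rfl fun i _ => ?_
  rw [mul_assoc, ← map_mul, w_val_mul_z]

lemma sum_q_z_condExp_apply (b : secondCentralizer j) (t x : S) :
    ∑ i, eval j (D.q i) (D.z.1 * Q.condExp ((D.p i).1 * leftRegular j (D.w.1 * t) * b.1) * x) =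
      t * eval j b x := by
  have h := congrArg (fun c => toEnd j c x) (D.sum_q_z_condExp (leftRegular j t * b.1))
  simp only [map_sum, LinearMap.sum_apply, map_mul (toEnd j), Module.End.mul_apply,
    leftRegular_apply] at h
  rw [← eval_apply] at h
  rw [← h]
  refine Finset.sum_congr rfl fun i _ => ?_
  rw [map_mul (leftRegular j), eval_apply]
  simp only [mul_assoc]

/-- Paired with `t`, the left side becomes `∑ q_i(z E(p_i w t b))`, which the flipped expansion
evaluates to `t b(1)`. -/
lemma sum_conv_mul_antipode (b : secondCentralizer j) :
    ∑ i, Q.conv b (D.p i) * D.antipode (D.q i) = left j (evalCentralizer 1 b) := by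
  refine SecondCentralizer.ext fun y => D.eq_of_weightedE_mul_left fun t => ?_
  simp only [map_sum, LinearMap.sum_apply, Finset.mul_sum, eval_mul_apply,
    weightedE_eval_conv_mul, weightedE_mul_antipode]
  have h := D.sum_q_z_condExp_apply b t 1
  simp only [mul_one] at h
  rw [← map_sum, ← Finset.sum_mul, h, eval_left_apply, evalCentralizer_val, ← mul_assoc]
  rfl

/-- Paired with `t`, the left side is `b₁(t) b₂(y) = b(ty)`; one more use of adjointness, with
second argument `1`, turns this into `t y S(b)(1)`. -/
lemma sum_antipode_conv_mul (b : secondCentralizer j) :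
    ∑ i, D.antipode (Q.conv b (D.p i)) * D.q i =
      right j (evalCentralizer 1 (D.antipode b)) := by
  refine SecondCentralizer.ext fun y => D.eq_of_weightedE_mul_left fun t => ?_
  simp only [map_sum, LinearMap.sum_apply, Finset.mul_sum, eval_mul_apply,
    weightedE_mul_antipode]
  rw [← map_sum, D.sum_eval_conv_mul_eval, eval_right_apply, ← mul_assoc, evalCentralizer_val,
    weightedE_mul_antipode]
  simp

/-- Adjointness of `b` and `S(b)` at the pair `(v, 1)`, followed by the trace `T`. -/
lemma weight_evalCentralizer (b : secondCentralizer j) (v : centralizerOf j) :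
    D.weight (evalCentralizer v b) = D.weight (evalCentralizer 1 (D.antipode b) * v) := by
  rw [weight_comm]
  have h := congrArg Q.T (D.weightedE_mul_antipode b v.1 1)
  rw [mul_one] at h
  exact h.symm

lemma sum_weight_smul_right (b : secondCentralizer j) :
    ∑ l, D.counit (b * left j (D.t l)) • right j (D.s l) =
      right j (evalCentralizer 1 (D.antipode b)) := by
  conv_rhs => rw [← D.sum_weight_mul (evalCentralizer 1 (D.antipode b)), map_sum]
  refine Finset.sum_congr rfl fun l _ => ?_
  rw [map_smul]
  congr 1
  rw [weight_comm, ← weight_evalCentralizer, counit_apply]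
  congr 1
  refine Subtype.ext ?_
  rw [evalCentralizer_val, eval_mul_apply, eval_left_apply, OneMemClass.coe_one, mul_one]
  rfl

lemma sum_weight_smul_left (b : secondCentralizer j) :
    ∑ l, D.counit (right j (D.s l) * b) • left j (D.t l) = left j (evalCentralizer 1 b) := by
  conv_rhs => rw [← D.sum_weight_mul' (evalCentralizer 1 b), map_sum]
  simp only [map_smul, counit_right_mul]

/-- The axiom `S(b₁) b₂ S(b₃) = S(b)` after its first two factors have been contracted to a right
multiplication. -/
lemma sum_right_antipode_conv_mul (b : secondCentralizer j) :
    ∑ i, right j (evalCentralizer 1 (D.antipode (Q.conv b (D.p i)))) * D.antipode (D.q i) =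
      D.antipode b := by
  -- This value is an element of `V` in terms of the coordinates, and `∑ q_i` applied to its
  -- multiples is governed by the flipped dual basis expansion.
  have h : ∀ i, (evalCentralizer 1 (D.antipode (Q.conv b (D.p i)))).1 =
      D.z.1 * Q.condExp ((D.p i).1 * leftRegular j D.w.1 * b.1) := by
    intro i
    refine D.eq_of_weightedE_mul_left fun t => ?_
    rw [evalCentralizer_val, weightedE_mul_antipode, OneMemClass.coe_one, mul_one]
    have h1 := D.weightedE_eval_conv_mul b (D.p i) 1 t
    rw [one_mul, mul_one] at h1
    rw [h1]
    have h2 := D.weightedE_comm (D.z * Q.condExpCentralizer (D.p i * (left j D.w * b))) t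
    simp only [MulMemClass.coe_mul, Q.condExpCentralizer_val, left_val, ← mul_assoc] at h2 ⊢
    exact h2
  refine SecondCentralizer.ext fun y => D.eq_of_weightedE_mul_left fun t => ?_
  rw [weightedE_mul_antipode]
  simp only [map_sum, LinearMap.sum_apply, Finset.mul_sum, eval_mul_apply, eval_right_apply]
  simp only [← mul_assoc, ← D.weightedE_comm]
  simp only [D.weightedE_mul_antipode]
  rw [← map_sum, ← Finset.sum_mul]
  congr 2
  have h3 := D.sum_q_z_condExp_apply b 1 t
  simp only [one_mul, mul_one] at h3
  simp only [h, h3]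

end WeakHopfCoordinates

end WeakHopf

/-! ### The weak Hopf algebra, its module algebra and the smash product -/

section WeakHopf

variable {k R S : Type*} [Field k] [Ring R] [Algebra k R] [Ring S] [Algebra k S]
  {j : R →ₐ[k] S}

open SecondCentralizer

namespace WeakHopfCoordinates

variable {Q : MarkovExtension j} (D : WeakHopfCoordinates Q)

lemma lid_rTensor_counit_comul_one_mul (b : secondCentralizer j) :
    TensorProduct.lid k _ (LinearMap.rTensor _ D.counit
      (D.comul 1 * (b ⊗ₜ[k] (1 : secondCentralizer j)))) = left j (evalCentralizer 1 b) := by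
  rw [comul_one_eq, ← D.sum_weight_smul_left, Finset.sum_mul, map_sum, map_sum]
  simp

/-- The weak Hopf algebra structure on `C_{End(S_R)}(R)`. -/
@[reducible] noncomputable def weakHopfAlgebra : WeakHopfAlgebra k (secondCentralizer j) where
  comul := D.comul
  counit := D.counit
  coassoc := D.coassoc
  rTensor_counit_comp_comul := by
    ext b
    rw [LinearMap.comp_apply, comul_apply, map_sum]
    simp only [LinearMap.rTensor_tmul, TensorProduct.mk_apply]
    conv_rhs => rw [← D.sum_counit_smul b, TensorProduct.tmul_sum]
    refine Finset.sum_congr rfl fun i _ => ?_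
    rw [TensorProduct.tmul_smul, TensorProduct.smul_tmul', smul_eq_mul, mul_one]
  lTensor_counit_comp_comul := by
    ext b
    rw [LinearMap.comp_apply, comul_apply, map_sum]
    simp only [LinearMap.lTensor_tmul, TensorProduct.mk_apply, LinearMap.flip_apply]
    conv_rhs => rw [← D.sum_counit_smul' b, TensorProduct.sum_tmul]
    refine Finset.sum_congr rfl fun i _ => ?_
    rw [TensorProduct.smul_tmul, smul_eq_mul, mul_one]
  antipode := D.antipode
  comul_mul := D.comul_mul
  counit_mul_mul := D.counit_mul_mul
  counit_mul_mul' := D.counit_mul_mul'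
  comul_one := D.rTensor_comul_comul_one
  comul_one' := D.rTensor_comul_comul_one'
  mul_antipode b := by
    rw [lid_rTensor_counit_comul_one_mul, ← D.sum_conv_mul_antipode, comul_apply, map_sum, map_sum]
    rfl
  antipode_mul b := by
    rw [comul_apply, comul_one_eq, map_sum, map_sum, Finset.mul_sum, map_sum, map_sum]
    refine (D.sum_antipode_conv_mul b).trans ?_
    rw [← sum_weight_smul_right]
    simp
  antipode_mul_antipode b := by
    rw [D.comul_apply b, map_sum, map_sum]
    conv_rhs => rw [← D.sum_right_antipode_conv_mul]
    refine Finset.sum_congr rfl fun i _ => ?_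
    rw [TensorProduct.map_tmul, LinearMap.mul'_apply, ← D.sum_antipode_conv_mul,
      LinearMap.comp_apply, LinearMap.comp_apply, comul_apply, map_sum, map_sum]
    rfl

lemma targetMap_eq (b : secondCentralizer j) :
    letI := D.weakHopfAlgebra
    WeakHopfAlgebra.targetMap k b = left j (evalCentralizer 1 b) :=
  D.lid_rTensor_counit_comul_one_mul b

lemma mem_target_iff (b : secondCentralizer j) :
    letI := D.weakHopfAlgebra
    b ∈ WeakHopfAlgebra.target k (secondCentralizer j) ↔
      ∃ v ∈ centralizerOf j, leftRegular j v = b.1 := by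
  let _ := D.weakHopfAlgebra
  constructor
  · intro h
    exact ⟨_, (evalCentralizer 1 b).2,
      congrArg Subtype.val ((D.targetMap_eq b).symm.trans h)⟩
  · rintro ⟨v, hv, h⟩
    obtain rfl : left j ⟨v, hv⟩ = b := Subtype.ext h
    refine (D.targetMap_eq _).trans ?_
    congr 1
    exact Subtype.ext (mul_one v)

/-- The evaluation action of `C_{End(S_R)}(R)` on `S`. -/
@[reducible] noncomputable def moduleAlgebra :
    letI := D.weakHopfAlgebra
    WeakHopfAlgebra.ModuleAlgebra k (secondCentralizer j) S :=
  letI := D.weakHopfAlgebra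
  { act := eval j
    act_mul := fun b x y => by
      rw [← D.sum_eval_conv_mul_eval]
      show _ = LinearMap.mul' k S (TensorProduct.map _ _ (D.comul b))
      rw [comul_apply, map_sum, map_sum]
      rfl
    act_one := fun b => by
      rw [targetMap_eq, eval_left_apply, mul_one]
      rfl }

/-- The map `x ⊗ b ↦ x b`. -/
def mulMap : S ⊗[k] secondCentralizer j →ₗ[k] BasicConstruction j :=
  LinearMap.mul' k (BasicConstruction j) ∘ₗ
    TensorProduct.map (leftRegular j).toLinearMap (secondCentralizer j).val.toLinearMap

section Smash

open WeakHopfAlgebra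

lemma mulMap_smashRel :
    letI := D.weakHopfAlgebra
    letI := D.moduleAlgebra
    smashRel k (secondCentralizer j) S ≤ LinearMap.ker (mulMap (j := j)) := by
  let _ := D.weakHopfAlgebra
  let _ := D.moduleAlgebra
  refine Submodule.span_le.2 ?_
  rintro _ ⟨x, b, c, hc, rfl⟩
  obtain ⟨v, hv, h⟩ := (D.mem_target_iff c).1 hc
  obtain rfl : left j ⟨v, hv⟩ = c := Subtype.ext h
  rw [SetLike.mem_coe, LinearMap.mem_ker, map_sub, sub_eq_zero]
  -- An element of the target subalgebra is left multiplication by some `v`, and its value at `1` is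
  -- `v * 1`.
  show leftRegular j (x * (v * 1)) * b.1 = leftRegular j x * (leftRegular j v * b.1)
  rw [mul_one, map_mul (leftRegular j), mul_assoc]

/-- The map `x # b ↦ x b`. -/
noncomputable def smashMap :
    letI := D.weakHopfAlgebra
    letI := D.moduleAlgebra
    SmashProduct k (secondCentralizer j) S →ₗ[k] BasicConstruction j :=
  letI := D.weakHopfAlgebra
  letI := D.moduleAlgebra
  Submodule.liftQ _ mulMap D.mulMap_smashRel

lemma smashMap_smash (x : S) (b : secondCentralizer j) :
    letI := D.weakHopfAlgebra
    letI := D.moduleAlgebra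
    D.smashMap (smash k x b) = leftRegular j x * b.1 := rfl

lemma smashMap_mul :
    letI := D.weakHopfAlgebra
    letI := D.moduleAlgebra
    ∀ X Y : SmashProduct k (secondCentralizer j) S,
      D.smashMap (X * Y) = D.smashMap X * D.smashMap Y := by
  let _ := D.weakHopfAlgebra
  let _ := D.moduleAlgebra
  intro X Y
  obtain ⟨X, rfl⟩ := smashQuot_surjective k X
  obtain ⟨Y, rfl⟩ := smashQuot_surjective k Y
  induction X with
  | zero => simp
  | add X X' hX hX' => simp only [map_add, add_mul, hX, hX']
  | tmul x b =>
  induction Y with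
  | zero => simp
  | add Y Y' hY hY' => simp only [map_add, mul_add, hY, hY']
  | tmul y c =>
  have key : ∀ T : secondCentralizer j ⊗[k] secondCentralizer j,
      mulMap (j := j) ((x ⊗ₜ[k] (1 : secondCentralizer j)) *
        LinearMap.rTensor (secondCentralizer j) ((eval j).toLinearMap.flip y) T *
        ((1 : S) ⊗ₜ[k] c)) = leftRegular j x * evalMul y T * c.1 := by
    intro T
    induction T with
    | zero => simp
    | add T U hT hU => simp only [map_add, mul_add, add_mul, hT, hU]
    | tmul p q =>
      rw [LinearMap.rTensor_tmul, Algebra.TensorProduct.tmul_mul_tmul,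
        Algebra.TensorProduct.tmul_mul_tmul, one_mul, mul_one, evalMul_tmul]
      show leftRegular j (x * eval j p y) * (q.1 * c.1) = _
      rw [map_mul (leftRegular j)]
      simp only [mul_assoc]
  refine (congrArg D.smashMap (smash_mul_smash k x y b c)).trans ?_
  refine (key (D.comul b)).trans ?_
  rw [evalMul_comul, ← mul_assoc, mul_assoc _ _ c.1]
  rfl

/-- The inverse is `c ↦ ∑ E(c p_i) # q_i`. One composite is the dual basis expansion in `End(S_R)`,
the other its version inside `B` with coefficients in `V`. -/
lemma smashMap_bijective :
    letI := D.weakHopfAlgebra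
    letI := D.moduleAlgebra
    Function.Bijective D.smashMap := by
  let _ := D.weakHopfAlgebra
  let _ := D.moduleAlgebra
  have h2 : ∀ X : SmashProduct k (secondCentralizer j) S,
      ∑ i, smash k (Q.condExp (D.smashMap X * (D.p i).1)) (D.q i) = X := by
    intro X
    obtain ⟨X, rfl⟩ := smashQuot_surjective k X
    induction X with
    | zero => simp [smash]
    | add X X' hX hX' =>
      simp only [smash] at hX hX' ⊢
      simp only [map_add, add_mul, TensorProduct.add_tmul, Finset.sum_add_distrib, hX, hX']
    | tmul x b =>
      -- Here `E(x b p_i) = x E(b p_i)` with `E(b p_i) ∈ V`, so the balancing relation carries this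
      -- factor across to `q_i`.
      have h3 : ∀ i, smash k (Q.condExp (leftRegular j x * b.1 * (D.p i).1)) (D.q i) =
          smashQuot k (secondCentralizer j) S (x ⊗ₜ[k]
            (left j (Q.condExpCentralizer (b * D.p i)) * D.q i)) := by
        intro i
        rw [← smashQuot_rel k x ((D.mem_target_iff _).2
          ⟨_, (Q.condExpCentralizer (b * D.p i)).2, rfl⟩), mul_assoc, Q.condExp_mul_left]
        show _ = smashQuot k (secondCentralizer j) S
          ((x * (Q.condExp (b.1 * (D.p i).1) * 1)) ⊗ₜ[k] D.q i)
        rw [mul_one]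
        rfl
      refine (Finset.sum_congr rfl fun i _ => h3 i).trans ?_
      rw [← map_sum, ← TensorProduct.tmul_sum, D.sum_condExpCentralizer_mul]
  refine Function.bijective_iff_has_inverse.2
    ⟨fun c => ∑ i, smash k (Q.condExp (c * (D.p i).1)) (D.q i), h2, fun c => ?_⟩
  rw [map_sum]
  exact D.sum_condExp_mul c

/-- The isomorphism `x # b ↦ x b` from the smash product onto `End(S_R)`. -/
noncomputable def smashEquiv :
    letI := D.weakHopfAlgebra
    letI := D.moduleAlgebra
    SmashProduct k (secondCentralizer j) S ≃ₐ[k] BasicConstruction j :=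
  letI := D.weakHopfAlgebra
  letI := D.moduleAlgebra
  AlgEquiv.ofLinearEquiv (LinearEquiv.ofBijective D.smashMap D.smashMap_bijective)
    ((D.smashMap_smash 1 1).trans (by
      rw [map_one (leftRegular j), OneMemClass.coe_one, mul_one])) D.smashMap_mul

lemma smashEquiv_smash (x : S) (b : secondCentralizer j) :
    letI := D.weakHopfAlgebra
    letI := D.moduleAlgebra
    D.smashEquiv (smash k x b) = leftRegular j x * b.1 := rfl

end Smash

end WeakHopfCoordinates

/-- Right `R`-linearity of `c` gives `c x e = c(x) e`, since `e` has values in `R`. For `c ∈ B` this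
is the formula for the action. -/
lemma MarkovExtension.condExp_mul_jones (Q : MarkovExtension j) (c : BasicConstruction j) (x : S) :
    Q.condExp (c * leftRegular j x * Q.jones) = Q.lam • toEnd j c x := by
  have h : c * leftRegular j x * Q.jones =
      leftRegular j (toEnd j c x) * Q.jones * leftRegular j 1 := by
    refine BasicConstruction.ext' fun y => ?_
    rw [map_one, mul_one]
    exact BasicConstruction.toEnd_mul_apply c x (Q.E y)
  rw [h, Q.condExp_mul_jones_mul, mul_one]

end WeakHopf

/-! ### Symmetric separability elements and traces -/

section Separability

variable {k U : Type*} [Field k] [Ring U] [Algebra k U]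

namespace IsSymmetricSeparabilityElement

variable {m : ℕ} {s t : Fin m → U}

lemma sum_casimir (hf : IsSymmetricSeparabilityElement k (∑ l, s l ⊗ₜ[k] t l)) (v : U) :
    ∑ l, (v * s l) ⊗ₜ[k] t l = ∑ l, s l ⊗ₜ[k] (t l * v) := by
  simpa [Finset.mul_sum, Finset.sum_mul] using hf.casimir v

lemma sum_mul (hf : IsSymmetricSeparabilityElement k (∑ l, s l ⊗ₜ[k] t l)) :
    ∑ l, s l * t l = 1 := by
  simpa using hf.mul_eq_one

lemma sum_symm (hf : IsSymmetricSeparabilityElement k (∑ l, s l ⊗ₜ[k] t l)) :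
    ∑ l, t l ⊗ₜ[k] s l = ∑ l, s l ⊗ₜ[k] t l := by
  simpa using hf.symm

/-- The inner Casimir identity is the flip of the outer one, and the element is fixed by the flip.
-/
lemma sum_casimir' (hf : IsSymmetricSeparabilityElement k (∑ l, s l ⊗ₜ[k] t l)) (v : U) :
    ∑ l, (s l * v) ⊗ₜ[k] t l = ∑ l, s l ⊗ₜ[k] (v * t l) := by
  have h1 := congrArg (TensorProduct.map (LinearMap.mulRight k v) LinearMap.id) hf.sum_symm
  have h2 := congrArg (TensorProduct.map LinearMap.id (LinearMap.mulLeft k v)) hf.sum_symm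
  have h3 := congrArg (TensorProduct.comm k U U) (hf.sum_casimir v)
  simp only [map_sum, TensorProduct.map_tmul, LinearMap.mulRight_apply, LinearMap.mulLeft_apply,
    LinearMap.id_apply, TensorProduct.comm_tmul] at h1 h2 h3
  rw [← h1, ← h2, h3]

/-- The tensor `∑ s s' ⊗ t' t` is computed in two ways: the inner identity of `f` collapses it to
`f`, the outer identity of `f'` to `f'`. -/
lemma unique {f f' : U ⊗[k] U} (hf : IsSymmetricSeparabilityElement k f)
    (hf' : IsSymmetricSeparabilityElement k f') : f' = f := by
  obtain ⟨m, s, t, rfl⟩ := TensorProduct.exists_sum_tmul_eq f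
  obtain ⟨n, s', t', rfl⟩ := TensorProduct.exists_sum_tmul_eq f'
  have h1 : ∀ l', ∑ l, (s l * s' l') ⊗ₜ[k] (t' l' * t l) =
      ∑ l, s l ⊗ₜ[k] (t' l' * s' l' * t l) := by
    intro l'
    have := congrArg (TensorProduct.map LinearMap.id (LinearMap.mulLeft k (t' l')))
      (hf.sum_casimir' (s' l'))
    simpa [mul_assoc] using this
  have h2 : ∀ l, ∑ l', (s l * s' l') ⊗ₜ[k] (t' l' * t l) =
      ∑ l', s' l' ⊗ₜ[k] (t' l' * (s l * t l)) := by
    intro l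
    have := congrArg (TensorProduct.map LinearMap.id (LinearMap.mulRight k (t l)))
      (hf'.sum_casimir (s l))
    simpa [mul_assoc] using this
  have h3 : ∑ l', t' l' * s' l' = 1 := by
    have := congrArg (LinearMap.mul' k U) hf'.sum_symm
    simpa [hf'.sum_mul] using this
  calc ∑ l', s' l' ⊗ₜ[k] t' l' = ∑ l', s' l' ⊗ₜ[k] (t' l' * ∑ l, s l * t l) := by
        simp [hf.sum_mul]
    _ = ∑ l, ∑ l', (s l * s' l') ⊗ₜ[k] (t' l' * t l) := by
        simp only [h2, Finset.mul_sum, TensorProduct.tmul_sum]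
        rw [Finset.sum_comm]
    _ = ∑ l, s l ⊗ₜ[k] ((∑ l', t' l' * s' l') * t l) := by
        rw [Finset.sum_comm]
        simp only [h1, Finset.sum_mul, TensorProduct.tmul_sum]
        rw [Finset.sum_comm]
    _ = _ := by simp [h3]

/-- With `f = ∑ b_i ⊗ β_i` over a basis `β`, the Casimir identity puts `v b_i` in the span of the
finitely many `b_l`. Then `v = ∑ v b_i β_i` lies in the span of the products `b_l β_i`. -/
lemma finite {f : U ⊗[k] U} (hf : IsSymmetricSeparabilityElement k f) : Module.Finite k U := by
  classical
  obtain ⟨b, hb⟩ := TensorProduct.eq_repr_basis_right (Module.Basis.ofVectorSpace k U) f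
  set β := Module.Basis.ofVectorSpace k U
  rw [Finsupp.sum] at hb
  subst hb
  have h1 : ∀ v i, v * b i = ∑ l ∈ b.support, β.coord i (β l * v) • b l := by
    intro v i
    have h := congrArg (fun T => TensorProduct.rid k U (LinearMap.lTensor U (β.coord i) T))
      (hf.casimir v)
    simp only [Finset.mul_sum, Finset.sum_mul, Algebra.TensorProduct.tmul_mul_tmul, one_mul,
      mul_one, map_sum, LinearMap.lTensor_tmul, TensorProduct.rid_tmul] at h
    rw [← h]
    simp only [Module.Basis.coord_apply, Module.Basis.repr_self, Finsupp.single_apply, ite_smul,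
      one_smul, zero_smul, Finset.sum_ite_eq']
    split_ifs with hi
    · rfl
    · rw [Finsupp.notMem_support_iff.1 hi, mul_zero]
  have h2 : ∑ i ∈ b.support, b i * β i = 1 := by simpa using hf.mul_eq_one
  refine ⟨(b.support ×ˢ b.support).image fun i => b i.1 * β i.2, ?_⟩
  refine eq_top_iff.2 fun v _ => ?_
  rw [← mul_one v, ← h2, Finset.mul_sum]
  refine Submodule.sum_mem _ fun i hi => ?_
  rw [← mul_assoc, h1, Finset.sum_mul]
  refine Submodule.sum_mem _ fun l hl => ?_
  rw [smul_mul_assoc]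
  exact Submodule.smul_mem _ _ (Submodule.subset_span (Finset.mem_coe.2
    (Finset.mem_image.2 ⟨(l, i), Finset.mem_product.2 ⟨hl, hi⟩, rfl⟩)))

/-- A symmetric separability element is dual, up to a central unit, to a non-degenerate trace. -/
lemma exists_dual {f : U ⊗[k] U} (hf : IsSymmetricSeparabilityElement k f) (T : U →ₗ[k] k)
    (hT : ∀ u v, T (u * v) = T (v * u)) (hnd : ∀ u, (∀ v, T (u * v) = 0) → u = 0) :
    ∃ (m : ℕ) (s t : Fin m → U) (w z : U), f = ∑ l, s l ⊗ₜ[k] t l ∧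
      z = TensorProduct.rid k U (LinearMap.lTensor U T f) ∧ z * w = 1 ∧ w * z = 1 ∧
      (∀ v, w * v = v * w) ∧ ∀ v, ∑ l, T (w * (t l * v)) • s l = v := by
  have := hf.finite
  let β := Module.finBasis k U
  obtain ⟨b, hb⟩ := TensorProduct.eq_repr_basis_right β f
  rw [Finsupp.sum_fintype _ _ (by simp)] at hb
  subst hb
  let F : U →ₗ[k] U ⊗[k] U →ₗ[k] U :=
    LinearMap.mk₂ k (fun v X => TensorProduct.rid k U (LinearMap.lTensor U
      (T ∘ₗ LinearMap.mulRight k v) X))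
      (fun v v' X => by
        rw [← map_add, ← LinearMap.add_apply, ← LinearMap.lTensor_add]
        congr 3
        ext u
        simp [mul_add])
      (fun c v X => by
        rw [← map_smul, ← LinearMap.smul_apply, ← LinearMap.lTensor_smul]
        congr 3
        ext u
        simp) (by simp) (by simp)
  have hF : ∀ v (s t : Fin (Module.finrank k U) → U),
      F v (∑ l, s l ⊗ₜ[k] t l) = ∑ l, T (t l * v) • s l := fun v s t => by simp [F]
  set z := ∑ l, T (β l) • b l with hz
  have h1 : ∀ v, ∑ l, T (β l * v) • b l = v * z := by
    intro v
    have h := congrArg (F 1) (hf.sum_casimir v)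
    rw [hF, hF] at h
    simp only [mul_one] at h
    rw [← h, hz, Finset.mul_sum]
    simp only [mul_smul_comm]
  -- Centrality combines the inner Casimir identity with the trace property.
  have hcomm : ∀ v, z * v = v * z := by
    intro v
    have h := congrArg (F 1) (hf.sum_casimir' v)
    rw [hF, hF] at h
    simp only [mul_one, hT v] at h
    rw [← h1, ← h, hz, Finset.sum_mul]
    simp only [smul_mul_assoc]
  -- If `v z = 0`, the symmetry of `f` gives `∑ T(b_l v) β_l = 0`, and the inner identity allows any
  -- `c` after `b_l`. Linear independence of `β` makes each `T(b_l c v)` vanish, and `∑ b_l β_l = 1`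
  -- then gives `T(v d) = 0` for all `d`.
  have hinj : Function.Injective (LinearMap.mulRight k z) := by
    refine (injective_iff_map_eq_zero _).2 fun v hv => hnd v fun d => ?_
    rw [LinearMap.mulRight_apply, ← h1] at hv
    have h2 : ∑ l, T (b l * v) • β l = 0 := by
      rw [← hv, ← hF, ← hF, hf.sum_symm]
    have h3 : ∀ c, ∑ l, T (b l * c * v) • β l = 0 := by
      intro c
      have h := congrArg (F v) (congrArg (TensorProduct.comm k U U) (hf.sum_casimir' c))
      simp only [map_sum, TensorProduct.comm_tmul] at h
      rw [← map_sum, ← map_sum, hF, hF] at h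
      rw [h]
      simp only [← mul_smul_comm]
      rw [← Finset.mul_sum, h2, mul_zero]
    have h4 : ∀ c l, T (b l * c * v) = 0 := fun c l =>
      Fintype.linearIndependent_iff.1 β.linearIndependent _ (h3 c) l
    rw [hT, ← one_mul d, ← hf.sum_mul, Finset.sum_mul, Finset.sum_mul, map_sum]
    refine Finset.sum_eq_zero fun l _ => ?_
    rw [mul_assoc (b l), h4]
  -- Finite dimension turns injectivity of multiplication by `z` into invertibility of `z`.
  obtain ⟨w, hw⟩ := LinearMap.injective_iff_surjective.1 hinj 1
  rw [LinearMap.mulRight_apply] at hw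
  have hw' : z * w = 1 := by rw [hcomm, hw]
  have hwc : ∀ v, w * v = v * w := fun v => by
    calc w * v = w * (v * z) * w := by rw [mul_assoc, mul_assoc, hw', mul_one]
      _ = v * w := by rw [← hcomm, ← mul_assoc, hw, one_mul]
  refine ⟨_, b, β, w, z, rfl, by simp [hz], hw', hw, hwc, fun v => ?_⟩
  simp only [hT w, mul_assoc]
  rw [h1, mul_assoc, hw, mul_one]

end IsSymmetricSeparabilityElement

/-- Dual bases with respect to a trace form a symmetric tensor. -/
lemma sum_tmul_symm_of_trace {κ : Type*} [Fintype κ] (T : U →ₗ[k] k)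
    (hT : ∀ u v, T (u * v) = T (v * u)) (a b : κ → U)
    (h : ∀ u, ∑ i, T (b i * u) • a i = u) :
    ∑ i, b i ⊗ₜ[k] a i = ∑ i, a i ⊗ₜ[k] b i := by
  calc ∑ i, b i ⊗ₜ[k] a i = ∑ i, (∑ l, T (b l * b i) • a l) ⊗ₜ[k] a i := by simp only [h]
    _ = ∑ l, a l ⊗ₜ[k] ∑ i, T (b i * b l) • a i := by
      simp only [TensorProduct.sum_tmul, TensorProduct.tmul_sum, TensorProduct.smul_tmul]
      rw [Finset.sum_comm]
      simp only [hT (b _) (b _)]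
    _ = _ := by simp only [h]

end Separability

/-! ### Centralizers and traces in the Jones tower -/

section Tower

variable {k N M : Type*} [Field k] [Ring N] [Algebra k N] [Ring M] [Algebra k M]
  {ι : N →ₐ[k] M}

lemma mem_centralizerOf_leftRegular_iff {v : BasicConstruction ι} :
    v ∈ centralizerOf (leftRegular ι) ↔ ∀ m x, toEnd ι v (m * x) = m * toEnd ι v x := by
  rw [mem_centralizerOf_iff]
  constructor
  · intro h m x
    exact (congrArg (fun g => toEnd ι g x) (h m)).symm
  · intro h m
    exact BasicConstruction.ext' fun x => (h m x).symm

variable (ι) in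
/-- Right multiplications by elements of `C_M(N)`, as elements of `C_{M₁}(M)`. -/
def rightMul : centralizerOf ι →ₗ[k] centralizerOf (leftRegular ι) where
  toFun u := ⟨(SecondCentralizer.right ι u).1, mem_centralizerOf_leftRegular_iff.2 fun m x =>
    mul_assoc m x u.1⟩
  map_add' u v := Subtype.ext (BasicConstruction.ext' fun m => mul_add m u.1 v.1)
  map_smul' c u := Subtype.ext (BasicConstruction.ext' fun m => mul_smul_comm c m u.1)

lemma toEnd_rightMul (u : centralizerOf ι) (m : M) : toEnd ι (rightMul ι u).1 m = m * u.1 := rfl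

lemma rightMul_mul (u v : centralizerOf ι) : rightMul ι (u * v) = rightMul ι v * rightMul ι u :=
  Subtype.ext (BasicConstruction.ext' fun m => (mul_assoc m u.1 v.1).symm)

lemma rightMul_one : rightMul ι 1 = 1 :=
  Subtype.ext (BasicConstruction.ext' fun m => mul_one m)

/-- A left `M`-linear endomorphism is right multiplication by its value at `1`, and right
`N`-linearity puts this value in `U`. -/
lemma rightMul_surjective (v : centralizerOf (leftRegular ι)) : ∃ u, rightMul ι u = v := by
  have h := mem_centralizerOf_leftRegular_iff.1 v.2
  refine ⟨⟨toEnd ι v.1 1, mem_centralizerOf_iff.2 fun n => ?_⟩, ?_⟩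
  · rw [← h, ← BasicConstruction.toEnd_mul_apply, mul_one, one_mul]
  · refine Subtype.ext (BasicConstruction.ext' fun m => ?_)
    rw [toEnd_rightMul, ← h, mul_one]

/-- `C_{M₁}(M)`, being opposite to `C_M(N)`, inherits Kanzaki separability from it. -/
lemma KanzakiSeparable.centralizerOf_leftRegular (h : KanzakiSeparable k (centralizerOf ι)) :
    KanzakiSeparable k (centralizerOf (leftRegular ι)) := by
  obtain ⟨f, hf⟩ := h
  obtain ⟨m, s, t, rfl⟩ := TensorProduct.exists_sum_tmul_eq f
  refine ⟨∑ l, rightMul ι (s l) ⊗ₜ[k] rightMul ι (t l), ?_, ?_, ?_⟩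
  · intro v
    obtain ⟨u, rfl⟩ := rightMul_surjective v
    have := congrArg (TensorProduct.map (rightMul ι) (rightMul ι)) (hf.sum_casimir' u)
    simpa [Finset.mul_sum, Finset.sum_mul, rightMul_mul] using this
  · have := congrArg (LinearMap.mul' k _) hf.sum_symm
    simp only [map_sum, LinearMap.mul'_apply, hf.sum_mul] at this
    simp only [map_sum, LinearMap.mul'_apply, ← rightMul_mul]
    rw [← map_sum, this, rightMul_one]
  · have := congrArg (TensorProduct.map (rightMul ι) (rightMul ι)) hf.sum_symm
    simpa using this

lemma toEnd_eval_mem {a : BasicConstruction ι} (ha : a ∈ secondCentralizer ι)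
    (b : secondCentralizer (leftRegular ι)) :
    SecondCentralizer.eval (leftRegular ι) b a ∈ secondCentralizer ι :=
  mem_centralizerOf_iff.2 fun n => by
    have h := mem_centralizerOf_iff.1 ha n
    simp only [AlgHom.comp_apply] at h ⊢
    rw [← SecondCentralizer.eval_left, h, SecondCentralizer.eval_right]

lemma leftRegular_mem_secondCentralizer (u : centralizerOf ι) :
    leftRegular ι u.1 ∈ secondCentralizer ι :=
  (SecondCentralizer.left ι u).2

lemma centralizerOf_leftRegular_le (v : centralizerOf (leftRegular ι)) :
    v.1 ∈ secondCentralizer ι :=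
  mem_centralizerOf_iff.2 fun n => centralizerOf_comm v (ι n)

namespace MarkovExtension

variable (P : MarkovExtension ι)

/-- `∑ x_i ⊗ y_i` is a Casimir element of `M ⊗_N M`; the hypothesis on `F` says that it is balanced
over `N`. -/
lemma casimir_lift {X : Type*} [AddCommGroup X] [Module k X] (F : M →ₗ[k] M →ₗ[k] X)
    (hF : ∀ m n m', F (m * ι n) m' = F m (ι n * m')) (m : M) :
    ∑ i, F (m * P.x i) (P.y i) = ∑ i, F (P.x i) (P.y i * m) := by
  calc ∑ i, F (m * P.x i) (P.y i)
      = ∑ i, ∑ l, F (P.x l * ι (P.E (P.y l * (m * P.x i)))) (P.y i) := by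
        refine Finset.sum_congr rfl fun i _ => ?_
        conv_lhs => rw [← (P.dual (m * P.x i)).2, map_sum, LinearMap.sum_apply]
    _ = ∑ l, ∑ i, F (P.x l) (ι (P.E (P.y l * m * P.x i)) * P.y i) := by
        rw [Finset.sum_comm]
        simp only [hF, mul_assoc]
    _ = _ := by
        refine Finset.sum_congr rfl fun l _ => ?_
        rw [← map_sum, (P.dual _).1]

lemma T₀_comm (a b : M) : P.T₀ (a * b) = P.T₀ (b * a) := P.T_E_mul_comm a b

lemma T₀_next (x : BasicConstruction ι) : P.next.T₀ x = P.T₀ (P.condExp x) := rfl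

lemma sum_leftRegular_mul_jones (x : BasicConstruction ι) :
    ∑ i, leftRegular ι (toEnd ι x (P.x i)) * P.jones * leftRegular ι (P.y i) = x := by
  refine BasicConstruction.ext' fun m => ?_
  rw [P.apply_eq_sum x m, map_sum, LinearMap.sum_apply]
  rfl

lemma jones_mul_leftRegular_mul_jones (m : M) :
    P.jones * leftRegular ι m * P.jones = leftRegular ι (ι (P.E m)) * P.jones := by
  refine BasicConstruction.ext' fun x => ?_
  show ι (P.E (m * ι (P.E x))) = ι (P.E m) * ι (P.E x)
  rw [P.E_right, map_mul]

lemma jones_comm (n : N) : leftRegular ι (ι n) * P.jones = P.jones * leftRegular ι (ι n) := by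
  refine BasicConstruction.ext' fun x => ?_
  show ι n * ι (P.E x) = ι (P.E (ι n * x))
  rw [P.E_left, map_mul]

lemma jones_mem : P.jones ∈ secondCentralizer ι :=
  mem_centralizerOf_iff.2 fun n => P.jones_comm n

lemma condExp_rightMul_mul_jones (u : centralizerOf ι) :
    P.condExp ((rightMul ι u).1 * P.jones) = P.lam • u.1 := by
  have h : (rightMul ι u).1 * P.jones = leftRegular ι u.1 * P.jones * leftRegular ι 1 := by
    refine BasicConstruction.ext' fun m => ?_
    rw [map_one, mul_one]
    exact (centralizerOf_comm u _)
  rw [h, P.condExp_mul_jones_mul, mul_one]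

variable {P}

lemma IsSymmetric.jones_mul_rightMul (hs : P.IsSymmetric) (u : centralizerOf ι) :
    P.jones * (rightMul ι u).1 = P.jones * leftRegular ι u.1 := by
  refine BasicConstruction.ext' fun m => ?_
  show ι (P.E (m * u.1)) = ι (P.E (u.1 * m))
  rw [hs u.1 u.2]

/-- For `v` the right multiplication by `u`, both sides are expanded in dual bases; symmetry of `E`
moves `u` from one end of the argument of `E` to the other. -/
lemma IsSymmetric.condExp_comm (hs : P.IsSymmetric) (v : centralizerOf (leftRegular ι))
    (x : BasicConstruction ι) : P.condExp (v.1 * x) = P.condExp (x * v.1) := by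
  obtain ⟨u, rfl⟩ := rightMul_surjective v
  rw [P.condExp_apply, P.condExp_apply]
  congr 1
  calc ∑ i, toEnd ι x (P.x i) * u.1 * P.y i
      = ∑ l, toEnd ι x (P.x l) * ∑ i, ι (P.E (u.1 * P.y l * P.x i)) * P.y i := by
        simp only [(P.dual _).1]
        simp only [mul_assoc]
    _ = ∑ i, (∑ l, toEnd ι x (P.x l) * ι (P.E (P.y l * (P.x i * u.1)))) * P.y i := by
        simp only [Finset.sum_mul, Finset.mul_sum]
        rw [Finset.sum_comm]
        simp only [mul_assoc, hs u.1 u.2]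
    _ = _ := by
        simp only [← P.apply_eq_sum]
        rfl

/-- Either product hypothesis suffices: the first gives it by cyclicity of `T₀`, and in the second
`∑ x_i u e₁ y_i` is exactly right multiplication by `u`. -/
lemma T₀_next_rightMul (hprod : P.SymmetricProduct ∨ P.TracePreserving) (u : centralizerOf ι) :
    P.next.T₀ (rightMul ι u).1 = P.T₀ u.1 := by
  rcases hprod with h | h
  · rw [T₀_next, P.condExp_apply, map_smul, map_sum]
    simp only [toEnd_rightMul]
    have h2 : ∀ i, P.T₀ (P.x i * u.1 * P.y i) = P.T₀ (u.1 * (P.y i * P.x i)) := fun i => by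
      rw [mul_assoc, T₀_comm, mul_assoc]
    simp only [h2]
    rw [← map_sum, ← Finset.mul_sum, show ∑ i, P.y i * P.x i = _ from h, mul_smul_comm, mul_one,
      map_smul, smul_smul, mul_inv_cancel₀ P.lam_ne_zero, one_smul]
  · rw [← h u.1 u.2]
    congr 1
    rw [← P.sum_leftRegular_mul_jones (rightMul ι u).1]
    rfl

lemma T₀_next_mul_jones (hprod : P.SymmetricProduct ∨ P.TracePreserving)
    (v : centralizerOf (leftRegular ι)) :
    P.next.T₀ (v.1 * P.jones) = P.lam * P.next.T₀ v.1 := by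
  obtain ⟨u, rfl⟩ := rightMul_surjective v
  rw [T₀_next, condExp_rightMul_mul_jones, map_smul, T₀_next_rightMul hprod, smul_eq_mul]

lemma eq_zero_of_T₀_next_centralizer (hprod : P.SymmetricProduct ∨ P.TracePreserving)
    (hirr : P.WeaklyIrreducible) (v : centralizerOf (leftRegular ι))
    (h : ∀ v' : centralizerOf (leftRegular ι), P.next.T₀ (v.1 * v'.1) = 0) : v = 0 := by
  obtain ⟨u, rfl⟩ := rightMul_surjective v
  have : u = 0 := Subtype.ext (hirr.2 u.1 u.2 fun u' hu' => by
    have h1 := h (rightMul ι ⟨u', hu'⟩)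
    rw [← MulMemClass.coe_mul, ← rightMul_mul, T₀_next_rightMul hprod, MulMemClass.coe_mul,
      T₀_comm] at h1
    exact h1)
  rw [this, map_zero]

/-- Dual bases of `E_M` inside `A` reduce non-degeneracy of `T₁` on `A` to that of `T₀` on `U`,
since `E_M(a c_i) ∈ U`. -/
lemma eq_zero_of_T₀_next_secondCentralizer (hirr : P.WeaklyIrreducible) (hdepth : P.DepthTwo)
    (a : secondCentralizer ι) (h : ∀ a' ∈ secondCentralizer ι, P.next.T₀ (a.1 * a') = 0) :
    a = 0 := by
  obtain ⟨n, c, d, hc, hd, hcd⟩ := hdepth.1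
  have h1 : ∀ i, P.condExp (a.1 * c i) = 0 := by
    intro i
    have hm : P.condExp (a.1 * c i) ∈ centralizerOf ι :=
      (P.condExpCentralizer ⟨a.1 * c i, mul_mem a.2 (hc i)⟩).2
    refine hirr.2 _ hm fun u hu => ?_
    rw [← P.condExp_mul_right, mul_assoc]
    exact h _ (mul_mem (hc i) (leftRegular_mem_secondCentralizer ⟨u, hu⟩))
  refine Subtype.ext ?_
  rw [← (hcd a.1).1]
  refine Finset.sum_eq_zero fun i _ => ?_
  rw [show P.next.E (a.1 * c i) = 0 from h1 i, map_zero, zero_mul]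

/-- By depth two, `M₂` is spanned by products of elements of `M`, `A` and `B`. The factor from `M`
commutes with `b` and comes out of both expectations, leaving an element that commutes with `N`. -/
lemma condExp_next_condExp_comm (hirr : P.WeaklyIrreducible) (hdepth : P.DepthTwo)
    (b : secondCentralizer (leftRegular ι)) (y : BasicConstruction (leftRegular ι)) :
    P.condExp (P.next.condExp (b.1 * y)) = P.condExp (P.next.condExp (y * b.1)) := by
  -- For `c` commuting with `N` the difference of the two sides lies in `U`. It is orthogonal to `U`
  -- because `T₂` is a trace and `b` commutes with `U ⊆ M`.
  have key : ∀ c : BasicConstruction (leftRegular ι),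
      (∀ n : N, leftRegular (leftRegular ι) (leftRegular ι (ι n)) * c =
        c * leftRegular (leftRegular ι) (leftRegular ι (ι n))) →
      P.condExp (P.next.condExp (b.1 * c)) = P.condExp (P.next.condExp (c * b.1)) := by
    intro c hc
    have hb : ∀ m, leftRegular (leftRegular ι) (leftRegular ι m) * b.1 =
        b.1 * leftRegular (leftRegular ι) (leftRegular ι m) := mem_centralizerOf_iff.1 b.2
    rw [← sub_eq_zero, ← map_sub, ← map_sub]
    refine hirr.2 _ (mem_centralizerOf_iff.2 fun n => ?_) fun u _ => ?_
    · rw [← P.condExp_mul_left, ← P.condExp_mul_right, ← P.next.condExp_mul_left,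
        ← P.next.condExp_mul_right]
      congr 2
      rw [mul_sub, sub_mul]
      congr 1
      · rw [← mul_assoc, hb, mul_assoc, hc, mul_assoc]
      · rw [← mul_assoc, hc, mul_assoc, hb, mul_assoc]
    · have h : P.next.next.T₀ (b.1 * c * leftRegular (leftRegular ι) (leftRegular ι u)) =
          P.next.next.T₀ (c * b.1 * leftRegular (leftRegular ι) (leftRegular ι u)) := by
        rw [mul_assoc, P.next.next.T₀_comm, mul_assoc c, mul_assoc, hb]
      rw [← P.condExp_mul_right, ← P.next.condExp_mul_right, sub_mul]
      show P.next.next.T₀ _ = 0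
      rw [map_sub, h, sub_self]
  obtain ⟨n, c, d, hc, hd, hcd⟩ := hdepth.1
  obtain ⟨n', c', d', hc', hd', hcd'⟩ := hdepth.2
  have hx : ∀ x : BasicConstruction ι, ∀ d ∈ secondCentralizer (leftRegular ι),
      P.condExp (P.next.condExp (b.1 * (leftRegular (leftRegular ι) x * d))) =
        P.condExp (P.next.condExp (leftRegular (leftRegular ι) x * d * b.1)) := by
    intro x e he
    rw [← (hcd x).1]
    simp only [map_sum, Finset.sum_mul, Finset.mul_sum]
    refine Finset.sum_congr rfl fun i _ => ?_
    set m := P.next.E (x * c i)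
    have h1 : b.1 * (leftRegular (leftRegular ι) (leftRegular ι m * d i) * e) =
        leftRegular (leftRegular ι) (leftRegular ι m) *
          (b.1 * (leftRegular (leftRegular ι) (d i) * e)) := by
      rw [map_mul (leftRegular (leftRegular ι)), mul_assoc, ← mul_assoc,
        SecondCentralizer.val_mul_leftRegular, mul_assoc]
    have h2 : leftRegular (leftRegular ι) (leftRegular ι m * d i) * e * b.1 =
        leftRegular (leftRegular ι) (leftRegular ι m) *
          (leftRegular (leftRegular ι) (d i) * e * b.1) := by
      rw [map_mul (leftRegular (leftRegular ι))]
      simp only [mul_assoc]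
    rw [h1, h2, P.next.condExp_mul_left, P.next.condExp_mul_left, P.condExp_mul_left,
      P.condExp_mul_left, key]
    intro n
    have h3 : leftRegular ι (ι n) * d i = d i * leftRegular ι (ι n) :=
      mem_centralizerOf_iff.1 (hd i) n
    have h4 : leftRegular (leftRegular ι) (leftRegular ι (ι n)) * e =
        e * leftRegular (leftRegular ι) (leftRegular ι (ι n)) := mem_centralizerOf_iff.1 he (ι n)
    rw [mul_assoc, ← h4, ← mul_assoc, ← mul_assoc, ← map_mul (leftRegular (leftRegular ι)),
      ← map_mul (leftRegular (leftRegular ι)), h3]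
  rw [← (hcd' y).1]
  simp only [map_sum, Finset.sum_mul, Finset.mul_sum]
  exact Finset.sum_congr rfl fun i _ => hx _ _ (hd' i)

end MarkovExtension

end Tower

/-! ### Coordinates for the tower and the duality pairing -/

section Tower

variable {k N M : Type*} [Field k] [Ring N] [Algebra k N] [Ring M] [Algebra k M]
  {ι : N →ₐ[k] M}

namespace MarkovExtension

open SecondCentralizer

variable {P : MarkovExtension ι}

lemma exists_weakHopfCoordinates (hsymm : P.IsSymmetric)
    (hprod : P.SymmetricProduct ∨ P.TracePreserving) (hirr : P.WeaklyIrreducible)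
    (hdepth : P.DepthTwo) :
    ∃ f : centralizerOf (leftRegular ι) ⊗[k] centralizerOf (leftRegular ι),
      IsSymmetricSeparabilityElement k f ∧
      ∃ D : WeakHopfCoordinates P.next, P.contract f = D.z := by
  obtain ⟨f, hf⟩ := hirr.1.centralizerOf_leftRegular
  refine ⟨f, hf, ?_⟩
  let T : centralizerOf (leftRegular ι) →ₗ[k] k :=
    P.next.T₀ ∘ₗ (centralizerOf (leftRegular ι)).val.toLinearMap
  obtain ⟨m, s, t, w, z, hfs, hz, hzw, hwz, hw, hT⟩ := hf.exists_dual T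
    (fun u v => P.next.T₀_comm u.1 v.1) (eq_zero_of_T₀_next_centralizer hprod hirr)
  rw [hfs] at hf
  obtain ⟨n, β, γ, hβ, hγ, hβγ⟩ := hdepth.2
  let β' : Fin n → secondCentralizer (leftRegular ι) := fun i => ⟨β i, hβ i⟩
  let γ' : Fin n → secondCentralizer (leftRegular ι) := fun i => ⟨γ i, hγ i⟩
  have hsum : ∑ l, leftRegular (leftRegular ι) (s l).1 * leftRegular (leftRegular ι) (t l).1 =
      1 := by
    have h := congrArg (fun v => (left (leftRegular ι) v).1) hf.sum_mul
    simp only [map_sum, map_mul, map_one, AddSubmonoidClass.coe_finsetSum, MulMemClass.coe_mul,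
      left_val, OneMemClass.coe_one] at h
    exact h
  -- The duality with the weight, rewritten with `w` on the first leg instead of inside the trace.
  have hT' : ∀ v : centralizerOf (leftRegular ι), ∑ l, T (t l * v) • (s l * w) = v := by
    intro v
    have h := congrArg (· * w) (hT (v * z))
    simp only [Finset.sum_mul, smul_mul_assoc, mul_assoc, hzw, mul_one] at h
    conv_rhs => rw [← h]
    refine Finset.sum_congr rfl fun l _ => ?_
    congr 1
    have h2 : T (w * (t l * (v * z))) = T (t l * (v * z) * w) :=
      P.next.T₀_comm _ _
    rw [h2, mul_assoc, mul_assoc, hzw, mul_one]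
  refine ⟨{
    m := m
    s := s
    t := t
    casimir := hf.sum_casimir
    sum_mul := hf.sum_mul
    symm := hf.sum_symm
    w := w
    z := z
    w_mul_z := hwz
    z_mul_w := hzw
    w_comm := hw
    sum_weight := hT
    κ := Fin n × Fin m
    -- The separability element is put between the given dual bases. They remain dual because `∑ s t
    -- = 1`, and a second insertion changes nothing.
    p := fun i => β' i.1 * left _ (s i.2)
    q := fun i => left _ (t i.2) * γ' i.1
    sum_condExp_mul := fun c => ?_
    sum_mul_condExp := fun c => ?_
    sum_sep := ?_
    sum_symm := ?_
    E_comm := hsymm.condExp_comm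
    condExp_comm := condExp_next_condExp_comm hirr hdepth }, hz.symm⟩
  · rw [Fintype.sum_prod_type]
    conv_rhs => rw [← (hβγ c).1]
    refine Finset.sum_congr rfl fun i _ => ?_
    have h : ∀ l, leftRegular (leftRegular ι) (P.next.condExp
        (c * (β' i * left (leftRegular ι) (s l)).1)) *
          (left (leftRegular ι) (t l) * γ' i).1 =
        leftRegular (leftRegular ι) (P.next.condExp (c * β i)) *
          (leftRegular (leftRegular ι) (s l).1 * leftRegular (leftRegular ι) (t l).1) * γ i := by
      intro l
      rw [MulMemClass.coe_mul, MulMemClass.coe_mul, left_val, left_val, ← mul_assoc c,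
        P.next.condExp_mul_right, map_mul (leftRegular (leftRegular ι))]
      simp only [mul_assoc]
      rfl
    simp only [h]
    rw [← Finset.sum_mul, ← Finset.mul_sum, hsum, mul_one]
    rfl
  · rw [Fintype.sum_prod_type]
    conv_rhs => rw [← (hβγ c).2]
    refine Finset.sum_congr rfl fun i _ => ?_
    have h : ∀ l, (β' i * left (leftRegular ι) (s l)).1 * leftRegular (leftRegular ι)
        (P.next.condExp ((left (leftRegular ι) (t l) * γ' i).1 * c)) =
        β i * (leftRegular (leftRegular ι) (s l).1 * leftRegular (leftRegular ι) (t l).1) *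
          leftRegular (leftRegular ι) (P.next.condExp (γ i * c)) := by
      intro l
      rw [MulMemClass.coe_mul, MulMemClass.coe_mul, left_val, left_val, mul_assoc _ _ c,
        P.next.condExp_mul_left, map_mul (leftRegular (leftRegular ι))]
      simp only [mul_assoc]
      rfl
    simp only [h]
    rw [← Finset.sum_mul, ← Finset.mul_sum, hsum, mul_one]
    rfl
  · rw [Fintype.sum_prod_type, Fintype.sum_prod_type]
    refine Finset.sum_congr rfl fun i _ => ?_
    let F := TensorProduct.map
      (LinearMap.mulLeft k (β' i) ∘ₗ (left (leftRegular ι)).toLinearMap)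
      (LinearMap.mulRight k (γ' i) ∘ₗ (left (leftRegular ι)).toLinearMap)
    have h1 : ∀ l, ∑ l', (s l * s l') ⊗ₜ[k] (t l' * t l) =
        ∑ l', s l' ⊗ₜ[k] (t l' * (s l * t l)) := by
      intro l
      have := congrArg (TensorProduct.map LinearMap.id (LinearMap.mulRight k (t l)))
        (hf.sum_casimir (s l))
      simpa [mul_assoc] using this
    -- Idempotence of the separability element in `V ⊗ Vᵒᵖ`.
    have h2 : ∑ l, ∑ l', (s l * s l') ⊗ₜ[k] (t l' * t l) = ∑ l, s l ⊗ₜ[k] t l := by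
      simp only [h1]
      rw [Finset.sum_comm]
      simp only [← TensorProduct.tmul_sum, ← Finset.mul_sum, hf.sum_mul, mul_one]
    have h3 := congrArg F h2
    simpa [F, mul_assoc] using h3
  -- The families `p_i w` and `q_i` are dual for the trace `T₂` on `B`, and such a tensor is
  -- symmetric.
  · refine sum_tmul_symm_of_trace
      (P.next.next.T₀ ∘ₗ (secondCentralizer (leftRegular ι)).val.toLinearMap)
      (fun u v => P.next.next.T₀_comm u.1 v.1) _ _ fun b => ?_
    rw [Fintype.sum_prod_type]
    have h : ∀ i, ∑ l, (P.next.next.T₀ ∘ₗ (secondCentralizer (leftRegular ι)).val.toLinearMap)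
        (left (leftRegular ι) (t l) * γ' i * b) •
          (β' i * left (leftRegular ι) (s l) * left (leftRegular ι) w) =
        β' i * left (leftRegular ι) (P.next.condExpCentralizer (γ' i * b)) := by
      intro i
      conv_rhs => rw [← hT' (P.next.condExpCentralizer (γ' i * b)), map_sum, Finset.mul_sum]
      refine Finset.sum_congr rfl fun l _ => ?_
      rw [map_smul, mul_smul_comm, map_mul (left (leftRegular ι)), mul_assoc]
      congr 1
      show P.next.T₀ (P.next.condExp (leftRegular (leftRegular ι) (t l).1 * γ i * b.1)) = _
      rw [mul_assoc, P.next.condExp_mul_left]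
      rfl
    simp only [h]
    refine Subtype.ext ?_
    rw [AddSubmonoidClass.coe_finsetSum]
    exact (hβγ b.1).2

/-- Cyclicity of `T₂` brings `b` in front of `a e₂`, and `E_{M₁}(b a e₂) = λ b(a)` uses up one
factor `λ⁻¹`. -/
lemma pairing_apply (w a : BasicConstruction ι) (b : secondCentralizer (leftRegular ι)) :
    P.pairing w a b =
      P.lam⁻¹ * P.next.T₀ (eval (leftRegular ι) b a * P.jones * w) := by
  have h : P.next.next.T₀ (leftRegular (leftRegular ι) a * P.next.jones *
      leftRegular (leftRegular ι) P.jones * leftRegular (leftRegular ι) w * b.1) =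
      P.lam * P.next.T₀ (eval (leftRegular ι) b a * P.jones * w) := by
    rw [T₀_comm, mul_assoc _ _ (leftRegular (leftRegular ι) w),
      ← map_mul (leftRegular (leftRegular ι)), ← mul_assoc, ← mul_assoc]
    show P.next.T₀ (P.next.condExp _) = _
    rw [P.next.condExp_mul_right, P.next.condExp_mul_jones, smul_mul_assoc, map_smul, mul_assoc]
    rfl
  show P.lam⁻¹ ^ 2 * P.next.next.T₀ _ = _
  refine (congrArg _ h).trans ?_
  rw [← mul_assoc, pow_two, mul_assoc P.lam⁻¹, inv_mul_cancel₀ P.lam_ne_zero, mul_one]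

lemma pairing'_apply (w a : BasicConstruction ι) (b : secondCentralizer (leftRegular ι)) :
    P.pairing' w a b =
      P.lam⁻¹ * P.next.T₀ (eval (leftRegular ι) b P.jones * w * a) := by
  have h : P.next.next.T₀ (b.1 * (leftRegular (leftRegular ι) P.jones * P.next.jones *
      leftRegular (leftRegular ι) w * leftRegular (leftRegular ι) a)) =
      P.lam * P.next.T₀ (eval (leftRegular ι) b P.jones * w * a) := by
    rw [mul_assoc _ _ (leftRegular (leftRegular ι) a),
      ← map_mul (leftRegular (leftRegular ι)), ← mul_assoc, ← mul_assoc]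
    show P.next.T₀ (P.next.condExp _) = _
    rw [P.next.condExp_mul_right, P.next.condExp_mul_jones, smul_mul_assoc, map_smul, mul_assoc]
    rfl
  show P.lam⁻¹ ^ 2 * P.next.next.T₀ _ = _
  refine (congrArg _ h).trans ?_
  rw [← mul_assoc, pow_two, mul_assoc P.lam⁻¹, inv_mul_cancel₀ P.lam_ne_zero, mul_one]

variable (D : WeakHopfCoordinates P.next)

/-- Adjointness of `b` and `S(b)` at the pair `(a, e₁)`, followed by `T₀`. -/
lemma pairing_eq_pairing'_antipode (a : BasicConstruction ι)
    (b : secondCentralizer (leftRegular ι)) :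
    P.pairing D.w.1 a b = P.pairing' D.w.1 a (D.antipode b) := by
  rw [pairing_apply, pairing'_apply]
  have h := congrArg P.T₀ (D.weightedE_mul_antipode b a P.jones)
  simp only [D.weightedE_apply] at h
  have h2 : P.next.T₀ (D.w.1 * (a * eval (leftRegular ι) (D.antipode b) P.jones)) =
      P.next.T₀ (D.w.1 * (eval (leftRegular ι) b a * P.jones)) := h
  rw [T₀_comm, ← h2, mul_assoc, T₀_comm P.next (eval _ _ _), mul_assoc]

/-- `M₁` is spanned by `M e₁ M`, so an `M`-bimodule map is determined by its value at `e₁`. -/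
lemma eq_zero_of_eval_jones {b : secondCentralizer (leftRegular ι)}
    (h : eval (leftRegular ι) b P.jones = 0) : b = 0 := by
  refine SecondCentralizer.ext fun x => ?_
  rw [← P.sum_leftRegular_mul_jones x]
  simp only [map_sum, eval_right, eval_left, h, map_zero, LinearMap.zero_apply, mul_zero, zero_mul]

/-- Through the antipode, the hypothesis says that `S(b)(e₁) w ∈ A` is orthogonal to `A` under `T₁`.
As `w` is a unit, `S(b)(e₁) = 0`, and `S` is injective. -/
lemma eq_zero_of_pairing_right (hirr : P.WeaklyIrreducible) (hdepth : P.DepthTwo)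
    (b : secondCentralizer (leftRegular ι))
    (h : ∀ a ∈ secondCentralizer ι, P.pairing D.w.1 a b = 0) : b = 0 := by
  refine D.antipode_injective ?_
  rw [map_zero]
  refine eq_zero_of_eval_jones (P := P) ?_
  have h1 := eq_zero_of_T₀_next_secondCentralizer hirr hdepth
    ⟨eval (leftRegular ι) (D.antipode b) P.jones * D.w.1,
      mul_mem (toEnd_eval_mem P.jones_mem _) (centralizerOf_leftRegular_le D.w)⟩ fun a ha => by
        have h2 := h a ha
        rw [pairing_eq_pairing'_antipode, pairing'_apply] at h2
        exact (mul_eq_zero.1 h2).resolve_left (inv_ne_zero P.lam_ne_zero)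
  have h2 : eval (leftRegular ι) (D.antipode b) P.jones * D.w.1 = 0 := congrArg Subtype.val h1
  rw [← mul_one (eval _ _ _), ← OneMemClass.coe_one (centralizerOf (leftRegular ι)), ← D.w_mul_z,
    MulMemClass.coe_mul, ← mul_assoc, h2, zero_mul]

/-- The bimodule endomorphism `x ↦ ∑ x_i e E_M(a y_i x)` of `M₁`. -/
def jonesConj (P : MarkovExtension ι) (a : secondCentralizer ι) :
    secondCentralizer (leftRegular ι) :=
  ofLinear (∑ i, LinearMap.mulLeft k (leftRegular ι (P.x i) * P.jones) ∘ₗ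
      (leftRegular ι).toLinearMap ∘ₗ P.condExp ∘ₗ LinearMap.mulLeft k (a.1 * leftRegular ι (P.y i)))
    (fun m x => by
      simp only [LinearMap.sum_apply, LinearMap.comp_apply, LinearMap.mulLeft_apply,
        AlgHom.toLinearMap_apply]
      -- Left `M`-linearity is the Casimir property of `∑ x_i ⊗ y_i`; the expression is balanced
      -- because `a` and `e₁` commute with `N`.
      have h := P.casimir_lift (LinearMap.mk₂ k (fun m m' => leftRegular ι m * P.jones *
        leftRegular ι (P.condExp (a.1 * leftRegular ι m' * x)))
        (by intros; simp only [map_add, add_mul]) (by intros; simp only [map_smul, smul_mul_assoc])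
        (by intros; simp only [map_add, mul_add, add_mul])
        (by intros; simp only [map_smul, smul_mul_assoc, mul_smul_comm]))
        (fun m n m' => by
          have ha : leftRegular ι (ι n) * a.1 = a.1 * leftRegular ι (ι n) :=
            mem_centralizerOf_iff.1 a.2 n
          simp only [LinearMap.mk₂_apply, map_mul (leftRegular ι)]
          rw [mul_assoc _ _ P.jones, P.jones_comm, ← mul_assoc a.1, ← ha, mul_assoc _ a.1,
            mul_assoc (leftRegular ι (ι n)) _ x, P.condExp_mul_left, map_mul (leftRegular ι)]
          simp only [mul_assoc]) m
      simp only [LinearMap.mk₂_apply, map_mul (leftRegular ι)] at h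
      simp only [← mul_assoc] at h ⊢
      rw [← h]
      simp only [Finset.mul_sum, mul_assoc])
    (fun x m => by
      simp only [LinearMap.sum_apply, LinearMap.comp_apply, LinearMap.mulLeft_apply,
        AlgHom.toLinearMap_apply, ← mul_assoc, P.condExp_mul_right, map_mul (leftRegular ι),
        Finset.sum_mul])

lemma eval_jonesConj (a : secondCentralizer ι) (x : BasicConstruction ι) :
    eval (leftRegular ι) (jonesConj P a) x = ∑ i, leftRegular ι (P.x i) * P.jones *
      leftRegular ι (P.condExp (a.1 * leftRegular ι (P.y i) * x)) := by
  simp [jonesConj, eval_ofLinear, LinearMap.sum_apply, mul_assoc]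

lemma T₀_next_mul_jones_mul_rightMul (hsymm : P.IsSymmetric) (m : M) (u : centralizerOf ι) :
    P.next.T₀ (leftRegular ι m * P.jones * (rightMul ι u).1) = P.lam * P.T₀ (u.1 * m) := by
  rw [mul_assoc, hsymm.jones_mul_rightMul, ← mul_assoc, T₀_next, P.condExp_mul_jones_mul, map_smul,
    T₀_comm, smul_eq_mul]

/-- The relation `e₁ m e₁ = E(m) e₁` and the symmetry of `E` reduce each term to a trace containing
`E(u x_i) y_i`, and these sum to `u`. Thus every functional `T₁(u a ·)` on `A` comes from the
pairing with `B`. -/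
lemma pairing_jonesConj (hsymm : P.IsSymmetric) (u : centralizerOf ι)
    (a a' : secondCentralizer ι) :
    P.pairing (rightMul ι u).1 a.1 (jonesConj P a') =
      P.next.T₀ (leftRegular ι u.1 * a.1 * a'.1) := by
  have h : ∀ i, P.next.T₀ (leftRegular ι (P.x i) * P.jones *
      leftRegular ι (P.condExp (a'.1 * leftRegular ι (P.y i) * a.1)) * P.jones *
        (rightMul ι u).1) =
      P.lam * P.next.T₀ (leftRegular ι (ι (P.E (u.1 * P.x i)) * P.y i) * (a.1 * a'.1)) := by
    intro i
    set m := P.condExp (a'.1 * leftRegular ι (P.y i) * a.1) with hm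
    have h1 : P.T₀ (u.1 * (P.x i * ι (P.E m))) = P.T₀ (ι (P.E (u.1 * P.x i)) * m) := by
      show P.T (P.E _) = P.T (P.E _)
      rw [← mul_assoc, P.E_right, P.E_left]
    have ha : leftRegular ι (ι (P.E (u.1 * P.x i))) * a'.1 =
        a'.1 * leftRegular ι (ι (P.E (u.1 * P.x i))) := mem_centralizerOf_iff.1 a'.2 _
    rw [mul_assoc (leftRegular ι (P.x i)), mul_assoc (leftRegular ι (P.x i)),
      P.jones_mul_leftRegular_mul_jones,
      ← mul_assoc, ← map_mul (leftRegular ι), T₀_next_mul_jones_mul_rightMul hsymm, h1, hm,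
      ← P.condExp_mul_left, ← T₀_next, ← mul_assoc, ← mul_assoc, ha,
      mul_assoc, mul_assoc, T₀_comm, ← mul_assoc _ _ a.1, ← map_mul (leftRegular ι), mul_assoc]
  rw [pairing_apply, eval_jonesConj, Finset.sum_mul, Finset.sum_mul, map_sum]
  simp only [h]
  rw [← Finset.mul_sum, ← mul_assoc, inv_mul_cancel₀ P.lam_ne_zero, one_mul, ← map_sum,
    ← Finset.sum_mul, ← map_sum, (P.dual _).1, mul_assoc]

lemma eq_zero_of_pairing_left (hsymm : P.IsSymmetric) (hirr : P.WeaklyIrreducible)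
    (hdepth : P.DepthTwo) (a : BasicConstruction ι) (ha : a ∈ secondCentralizer ι)
    (h : P.pairing D.w.1 a = 0) : a = 0 := by
  obtain ⟨u, hu⟩ := rightMul_surjective D.w
  obtain ⟨u', hu'⟩ := rightMul_surjective D.z
  have huu : u' * u = 1 := by
    have h1 : rightMul ι (u' * u) = 1 := by rw [rightMul_mul, hu, hu', D.w_mul_z]
    have h2 := congrArg (fun v => toEnd ι v.1 1) h1
    refine Subtype.ext ?_
    rw [← one_mul (u' * u).1]
    exact h2
  have h1 := eq_zero_of_T₀_next_secondCentralizer hirr hdepth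
    ⟨leftRegular ι u.1 * a, mul_mem (leftRegular_mem_secondCentralizer u) ha⟩ fun a' ha' => by
      rw [← hu] at h
      have h2 := pairing_jonesConj hsymm u ⟨a, ha⟩ ⟨a', ha'⟩
      rw [h, LinearMap.zero_apply] at h2
      exact h2.symm
  have h2 : leftRegular ι u.1 * a = 0 := congrArg Subtype.val h1
  rw [← one_mul a, ← map_one (leftRegular ι), ← OneMemClass.coe_one (centralizerOf ι), ← huu,
    MulMemClass.coe_mul, map_mul (leftRegular ι), mul_assoc, h2, mul_zero]

/-- On `N` the bimodule map `a` is right multiplication by `a(1) ∈ U`, and `e₁` has values in `N`.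
-/
lemma exists_mul_jones_eq (a : secondCentralizer ι) :
    ∃ v : centralizerOf (leftRegular ι), a.1 * P.jones = v.1 * P.jones := by
  refine ⟨rightMul ι (evalCentralizer 1 a), BasicConstruction.ext' fun m => ?_⟩
  show toEnd ι a.1 (ι (P.E m)) = ι (P.E m) * toEnd ι a.1 1
  have h := eval_left a (P.E m) 1
  rwa [mul_one] at h

lemma T₀_next_mul_jones_mul_w (hprod : P.SymmetricProduct ∨ P.TracePreserving)
    (v : centralizerOf (leftRegular ι)) :
    P.next.T₀ (v.1 * P.jones * D.w.1) = P.lam * D.weight v := by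
  rw [T₀_comm, ← mul_assoc]
  exact T₀_next_mul_jones hprod (D.w * v)

lemma counit_eq_pairing (hprod : P.SymmetricProduct ∨ P.TracePreserving)
    (b : secondCentralizer (leftRegular ι)) : D.counit b = P.pairing D.w.1 1 b := by
  have h := T₀_next_mul_jones_mul_w D hprod (evalCentralizer 1 b)
  rw [pairing_apply]
  refine Eq.trans ?_ (congrArg (P.lam⁻¹ * ·) h.symm)
  show _ = P.lam⁻¹ * _
  rw [← mul_assoc, inv_mul_cancel₀ P.lam_ne_zero, one_mul]
  rfl

/-- The core is `b(a₁a₂) = b₁(a₁) b₂(a₂)`. Writing `q_i(a₂) e₁ = v e₁` with `v ∈ V` makes the second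
pairing a weight, and the dual bases of `V` merge the two traces into one. -/
lemma pairing_comul (hprod : P.SymmetricProduct ∨ P.TracePreserving)
    {a₁ a₂ : BasicConstruction ι} (h₂ : a₂ ∈ secondCentralizer ι)
    (b : secondCentralizer (leftRegular ι)) :
    LinearMap.mul' k k (TensorProduct.map (P.pairing D.w.1 a₁) (P.pairing D.w.1 a₂)
      (D.comul b)) = P.pairing D.w.1 (a₁ * a₂) b := by
  have h := D.sep_lift ((LinearMap.mul k k).compl₁₂ (P.pairing D.w.1 a₁ ∘ₗ P.next.conv b)
    (P.pairing D.w.1 a₂))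
  simp only [LinearMap.compl₁₂_apply, LinearMap.comp_apply, P.next.conv_mul_left,
    LinearMap.mul_apply'] at h
  rw [D.comul_apply, map_sum, map_sum]
  simp only [TensorProduct.map_tmul, LinearMap.mul'_apply]
  rw [← h, pairing_apply, ← D.sum_eval_conv_mul_eval, Finset.sum_mul, Finset.sum_mul, map_sum,
    Finset.mul_sum]
  refine Finset.sum_congr rfl fun i _ => ?_
  set x := eval (leftRegular ι) (P.next.conv b (D.p i)) a₁ with hx
  obtain ⟨v, hv⟩ := exists_mul_jones_eq (P := P) ⟨_, toEnd_eval_mem h₂ (D.q i)⟩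
  have h1 : ∀ l, P.pairing D.w.1 a₁ (right (leftRegular ι) (D.s l) * P.next.conv b (D.p i)) *
      P.pairing D.w.1 a₂ (left (leftRegular ι) (D.t l) * D.q i) =
      P.lam⁻¹ * P.next.T₀ (x * (D.weight (D.t l * v) • D.s l).1 * P.jones * D.w.1) := by
    intro l
    have h3 := T₀_next_mul_jones_mul_w D hprod (D.t l * v)
    rw [pairing_apply, pairing_apply, eval_mul_apply, eval_right_apply, eval_mul_apply,
      eval_left_apply, mul_assoc (D.t l).1,
      show eval (leftRegular ι) (D.q i) a₂ * P.jones = _ from hv,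
      ← mul_assoc (D.t l).1, ← MulMemClass.coe_mul, h3, ← mul_assoc P.lam⁻¹ P.lam,
      inv_mul_cancel₀ P.lam_ne_zero, one_mul, SetLike.val_smul, mul_smul_comm, smul_mul_assoc,
      smul_mul_assoc, map_smul, smul_eq_mul, mul_comm (D.weight _), mul_assoc]
  simp only [h1]
  rw [← Finset.mul_sum, ← map_sum, ← Finset.sum_mul, ← Finset.sum_mul, ← Finset.mul_sum,
    ← AddSubmonoidClass.coe_finsetSum, D.sum_weight_mul, mul_assoc x v.1, ← hv,
    mul_assoc x _ P.jones]

end MarkovExtension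

end Tower

/-! ### The main theorem -/

theorem mainTheorem5 {k N M : Type*} [Field k] [Ring N] [Algebra k N] [Ring M] [Algebra k M]
    (ι : N →ₐ[k] M) (P : MarkovExtension ι) (hsymm : P.IsSymmetric)
    (hprod : P.SymmetricProduct ∨ P.TracePreserving) (hirr : P.WeaklyIrreducible)
    (hdepth : P.DepthTwo) :
    -- the unique symmetric separability element `f` of `V`, and `w = [f¹ T(f²)]⁻¹`
    ∃ f : centralizerOf (leftRegular ι) ⊗[k] centralizerOf (leftRegular ι),
    IsSymmetricSeparabilityElement k f ∧
    (∀ f' : centralizerOf (leftRegular ι) ⊗[k] centralizerOf (leftRegular ι),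
      IsSymmetricSeparabilityElement k f' → f' = f) ∧
    ∃ w : centralizerOf (leftRegular ι), P.contract f * w = 1 ∧ w * P.contract f = 1 ∧
    -- the duality form between `A` and `B` is non-degenerate
    (∀ a ∈ secondCentralizer ι, P.pairing w.1 a = 0 → a = 0) ∧
    (∀ b : secondCentralizer (leftRegular ι),
      (∀ a ∈ secondCentralizer ι, P.pairing w.1 a b = 0) → b = 0) ∧
    -- the weak Hopf algebra structure of `B`
    ∃ _ : WeakHopfAlgebra k (secondCentralizer (leftRegular ι)),
    (∀ a₁ ∈ secondCentralizer ι, ∀ a₂ ∈ secondCentralizer ι,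
      ∀ b : secondCentralizer (leftRegular ι),
      LinearMap.mul' k k (TensorProduct.map (P.pairing w.1 a₁) (P.pairing w.1 a₂)
        (Coalgebra.comul b)) = P.pairing w.1 (a₁ * a₂) b) ∧
    (∀ b : secondCentralizer (leftRegular ι), Coalgebra.counit b = P.pairing w.1 1 b) ∧
    (∀ a ∈ secondCentralizer ι, ∀ b : secondCentralizer (leftRegular ι),
      P.pairing w.1 a b = P.pairing' w.1 a (WeakHopfAlgebra.antipode (k := k) b)) ∧
    -- its target counital subalgebra is `V`
    (∀ b : secondCentralizer (leftRegular ι),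
      b ∈ WeakHopfAlgebra.target k (secondCentralizer (leftRegular ι)) ↔
        ∃ v ∈ centralizerOf (leftRegular ι), leftRegular (leftRegular ι) v = b.1) ∧
    -- the action of `B` on `M₁`
    ∃ _ : WeakHopfAlgebra.ModuleAlgebra k (secondCentralizer (leftRegular ι))
      (BasicConstruction ι),
    (∀ (b : secondCentralizer (leftRegular ι)) (x : BasicConstruction ι),
      WeakHopfAlgebra.ModuleAlgebra.act (k := k) b x =
        P.lam⁻¹ • P.next.next.E (b.1 * leftRegular (leftRegular ι) x * P.next.jones)) ∧
    -- the isomorphism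
    ∃ ψ : WeakHopfAlgebra.SmashProduct k (secondCentralizer (leftRegular ι))
        (BasicConstruction ι) ≃ₐ[k] BasicConstruction (leftRegular ι),
      ∀ (x : BasicConstruction ι) (b : secondCentralizer (leftRegular ι)),
        ψ (WeakHopfAlgebra.smash k x b) = leftRegular (leftRegular ι) x * b.1 := by
  obtain ⟨f, hf, D, hD⟩ := P.exists_weakHopfCoordinates hsymm hprod hirr hdepth
  refine ⟨f, hf, fun f' hf' => hf.unique hf', D.w, ?_, ?_,
    MarkovExtension.eq_zero_of_pairing_left D hsymm hirr hdepth,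
    MarkovExtension.eq_zero_of_pairing_right D hirr hdepth,
    D.weakHopfAlgebra, fun a₁ _ a₂ h₂ b => MarkovExtension.pairing_comul D hprod h₂ b,
    MarkovExtension.counit_eq_pairing D hprod,
    fun a _ b => MarkovExtension.pairing_eq_pairing'_antipode D a b,
    D.mem_target_iff, D.moduleAlgebra, fun b x => ?_, D.smashEquiv, D.smashEquiv_smash⟩
  · rw [hD, D.z_mul_w]
  · rw [hD, D.w_mul_z]
  -- The module structure is evaluation, so the action formula is `E_{M₁}(b x e₂) = λ b(x)`.
  · refine Eq.trans ?_ (congrArg (P.lam⁻¹ • ·) (P.next.condExp_mul_jones b.1 x)).symm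
    show _ = P.lam⁻¹ • P.lam • _
    rw [smul_smul, inv_mul_cancel₀ P.lam_ne_zero, one_smul]
    rfl
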